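/- Let $U$ and $V$ be finite-dimensional real inner product spaces and let $J\colon U\to\mathrm{End}(V)$, $z\mapsto J_z$, be a linear map with $|J_z(v)|=|z|\,|v|$ and $J_zJ_z(v)=-|z|^2v$ for all $z\in U$, $v\in V$. The associated H-type Lie algebra is $\mathcal N=U\oplus V$, where $U$ is central and, for $v_1,v_2\in V$, $[v_1,v_2]\in U$ is determined by $(z,[v_1,v_2])=(J_z(v_1),v_2)$ for all $z\in U$. Let $N$ be the set $U\oplus V$ with its usual topology and with the group law $X\cdot Y=X+Y+\tfrac12[X,Y]$. An integral basis consists of orthonormal bases $z_1,\dots,z_m$ of $U$ and $v_1,\dots,v_n$ of $V$ such that $[v_i,v_j]=\sum_k A^k_{ij}z_k$ with all $A^k_{ij}\in\{0,1,-1\}$; given one, let $U_{\mathbb Z}\subset U$ and $V_{\mathbb Z}\subset V$ be the sets of integer linear combinations of the $z_k$ and of the $v_i$, respectively. A cocompact lattice in a topological group $G$ is a discrete subgroup $\Gamma$ with $G/\Gamma$ compact. Then: 1. An integral basis exists. 2. For every integral basis, $L=\tfrac12U_{\mathbb Z}\oplus V_{\mathbb Z}$ is a cocompact lattice in $N$.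 If moreover $V\neq0$ or $U=0$, then the commutator subgroup $[L,L]$ of $L$ is $U_{\mathbb Z}$. 3. Every simply connected H-type Lie group has a cocompact lattice. More precisely, let $G$ be a simply connected Lie group and let $\varphi\colon\mathcal N\to\mathrm{Lie}(G)$ be an isomorphism of Lie algebras. Then $G$ has an exponential map $\exp$, the map $X\mapsto\exp(\varphi(X))$ is an isomorphism of topological groups from $N$ onto $G$, and for every integral basis the image of $L=\tfrac12U_{\mathbb Z}\oplus V_{\mathbb Z}$ under it is a cocompact lattice in $G$. -/

import Mathlib

open scoped Manifold ContDiff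

/-- An orthogonal multiplication of a finite-dimensional inner product space `U` on a
finite-dimensional inner product space `V`: a linear map `z ↦ J z` from `U` to `End V` with
`|J z v| = |z| |v|` and `J z (J z v) = -|z|² v`. -/
structure OrthogonalMultiplication (U V : Type*)
    [NormedAddCommGroup U] [InnerProductSpace ℝ U] [FiniteDimensional ℝ U]
    [NormedAddCommGroup V] [InnerProductSpace ℝ V] [FiniteDimensional ℝ V] where
  /-- the underlying linear map -/
  J : U →ₗ[ℝ] V →ₗ[ℝ] V
  norm_J : ∀ (z : U) (v : V), ‖J z v‖ = ‖z‖ * ‖v‖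
  J_J : ∀ (z : U) (v : V), J z (J z v) = -(‖z‖ ^ 2) • v

namespace OrthogonalMultiplication

variable {U V : Type*}
  [NormedAddCommGroup U] [InnerProductSpace ℝ U] [FiniteDimensional ℝ U]
  [NormedAddCommGroup V] [InnerProductSpace ℝ V] [FiniteDimensional ℝ V]

/-- The `U`-valued bracket of two elements of `V`; see `inner_pairing` for its characterization
`(z, [v, w]) = (J z v, w)`. -/
noncomputable def pairing (M : OrthogonalMultiplication U V) (v w : V) : U :=
  LinearMap.adjoint (M.J.flip v) w

theorem inner_pairing (M : OrthogonalMultiplication U V) (z : U) (v w : V) :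
    inner ℝ z (M.pairing v w) = inner ℝ (M.J z v) w := by
  simp [pairing, LinearMap.adjoint_inner_right]

theorem inner_J_self (M : OrthogonalMultiplication U V) (z : U) (v : V) :
    inner ℝ (M.J z v) v = 0 := by
  by_cases hz : z = 0
  · simp [hz]
  have hn : ‖z‖ ^ 2 ≠ 0 := by positivity
  have h1 : inner ℝ (M.J z (M.J z v + v)) (M.J z (M.J z v + v))
      = ‖z‖ ^ 2 * inner ℝ (M.J z v + v) (M.J z v + v) := by
    simp only [real_inner_self_eq_norm_sq, M.norm_J, mul_pow]
  have h2 : inner ℝ (M.J z v) (M.J z v) = ‖z‖ ^ 2 * inner ℝ v v := by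
    simp only [real_inner_self_eq_norm_sq, M.norm_J, mul_pow]
  rw [map_add, M.J_J] at h1
  simp only [inner_add_left, inner_add_right, inner_smul_left, inner_smul_right, h2,
    real_inner_comm (M.J z v) v, map_neg, conj_trivial] at h1
  have h3 : ‖z‖ ^ 2 * inner ℝ (M.J z v) v = 0 := by
    linarith
  exact (mul_eq_zero.mp h3).resolve_left hn

theorem pairing_self (M : OrthogonalMultiplication U V) (v : V) : M.pairing v v = 0 := by
  apply ext_inner_left ℝ
  intro z
  rw [M.inner_pairing, M.inner_J_self, inner_zero_right]

theorem pairing_add_left (M : OrthogonalMultiplication U V) (v v' w : V) :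
    M.pairing (v + v') w = M.pairing v w + M.pairing v' w := by
  simp [pairing]

theorem pairing_add_right (M : OrthogonalMultiplication U V) (v w w' : V) :
    M.pairing v (w + w') = M.pairing v w + M.pairing v w' := by
  simp [pairing]

theorem pairing_smul_right (M : OrthogonalMultiplication U V) (c : ℝ) (v w : V) :
    M.pairing v (c • w) = c • M.pairing v w := by
  simp [pairing]

theorem pairing_neg_right (M : OrthogonalMultiplication U V) (v w : V) :
    M.pairing v (-w) = -M.pairing v w := by
  simp [pairing]

theorem pairing_neg_left (M : OrthogonalMultiplication U V) (v w : V) :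
    M.pairing (-v) w = -M.pairing v w := by
  simp [pairing]

theorem pairing_zero_left (M : OrthogonalMultiplication U V) (w : V) : M.pairing 0 w = 0 := by
  simp [pairing]

theorem pairing_zero_right (M : OrthogonalMultiplication U V) (v : V) : M.pairing v 0 = 0 := by
  simp [pairing]

end OrthogonalMultiplication

section HType

variable {U V : Type*}
  [NormedAddCommGroup U] [InnerProductSpace ℝ U] [FiniteDimensional ℝ U]
  [NormedAddCommGroup V] [InnerProductSpace ℝ V] [FiniteDimensional ℝ V]

/-- The H-type Lie algebra `U ⊕ V` of an orthogonal multiplication. -/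
@[nolint unusedArguments]
def HTypeAlgebra (_M : OrthogonalMultiplication U V) : Type _ := U × V

namespace HTypeAlgebra

variable {M : OrthogonalMultiplication U V}

/-- The element `u + v` of `U ⊕ V`. -/
def mk (u : U) (v : V) : HTypeAlgebra M := (u, v)

noncomputable instance : AddCommGroup (HTypeAlgebra M) := inferInstanceAs (AddCommGroup (U × V))
noncomputable instance : Module ℝ (HTypeAlgebra M) := inferInstanceAs (Module ℝ (U × V))
instance : TopologicalSpace (HTypeAlgebra M) := inferInstanceAs (TopologicalSpace (U × V))

/-- `U` is central, and the bracket of two elements of `V` is `M.pairing`. -/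
noncomputable instance : Bracket (HTypeAlgebra M) (HTypeAlgebra M) :=
  ⟨fun X Y => mk (M.pairing X.2 Y.2) 0⟩

@[ext] theorem ext {X Y : HTypeAlgebra M} (h1 : X.1 = Y.1) (h2 : X.2 = Y.2) : X = Y :=
  Prod.ext h1 h2

@[simp] theorem add_fst (X Y : HTypeAlgebra M) : (X + Y).1 = X.1 + Y.1 := rfl
@[simp] theorem add_snd (X Y : HTypeAlgebra M) : (X + Y).2 = X.2 + Y.2 := rfl
@[simp] theorem neg_fst (X : HTypeAlgebra M) : (-X).1 = -X.1 := rfl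
@[simp] theorem neg_snd (X : HTypeAlgebra M) : (-X).2 = -X.2 := rfl
@[simp] theorem zero_fst : (0 : HTypeAlgebra M).1 = 0 := rfl
@[simp] theorem zero_snd : (0 : HTypeAlgebra M).2 = 0 := rfl
@[simp] theorem smul_fst (c : ℝ) (X : HTypeAlgebra M) : (c • X).1 = c • X.1 := rfl
@[simp] theorem smul_snd (c : ℝ) (X : HTypeAlgebra M) : (c • X).2 = c • X.2 := rfl
@[simp] theorem lie_fst (X Y : HTypeAlgebra M) : (⁅X, Y⁆ : HTypeAlgebra M).1 = M.pairing X.2 Y.2 :=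
  rfl
@[simp] theorem lie_snd (X Y : HTypeAlgebra M) : (⁅X, Y⁆ : HTypeAlgebra M).2 = 0 := rfl

noncomputable instance : LieRing (HTypeAlgebra M) where
  add_lie X Y Z := by ext <;> simp [M.pairing_add_left]
  lie_add X Y Z := by ext <;> simp [M.pairing_add_right]
  lie_self X := by ext <;> simp [M.pairing_self]
  leibniz_lie X Y Z := by ext <;> simp [M.pairing_zero_left, M.pairing_zero_right]

noncomputable instance : LieAlgebra ℝ (HTypeAlgebra M) where
  lie_smul c X Y := by ext <;> simp [M.pairing_smul_right]

end HTypeAlgebra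

/-- The H-type group of an orthogonal multiplication: the Lie algebra `U ⊕ V`, with its topology,
and with the product `X · Y = X + Y + ½ [X, Y]`. -/
def HTypeGroup (M : OrthogonalMultiplication U V) : Type _ := HTypeAlgebra M

namespace HTypeGroup

variable {M : OrthogonalMultiplication U V}

/-- The exponential map, which is the identity map of `U ⊕ V`. -/
def exp : HTypeAlgebra M ≃ HTypeGroup M := Equiv.refl _

/-- The inverse of the exponential map. -/
def log : HTypeGroup M ≃ HTypeAlgebra M := exp.symm

instance : TopologicalSpace (HTypeGroup M) := inferInstanceAs (TopologicalSpace (HTypeAlgebra M))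

noncomputable instance : Mul (HTypeGroup M) :=
  ⟨fun X Y => exp (log X + log Y + (1 / 2 : ℝ) • ⁅log X, log Y⁆)⟩
noncomputable instance : One (HTypeGroup M) := ⟨exp 0⟩
noncomputable instance : Inv (HTypeGroup M) := ⟨fun X => exp (-log X)⟩

theorem exp_mul_exp (X Y : HTypeAlgebra M) :
    exp X * exp Y = exp (X + Y + (1 / 2 : ℝ) • ⁅X, Y⁆) := rfl
theorem exp_zero : exp (0 : HTypeAlgebra M) = 1 := rfl
theorem exp_neg (X : HTypeAlgebra M) : exp (-X) = (exp X)⁻¹ := rfl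

noncomputable instance : Group (HTypeGroup M) :=
  Group.ofLeftAxioms
    (by
      intro X Y Z
      obtain ⟨X, rfl⟩ := exp.surjective X
      obtain ⟨Y, rfl⟩ := exp.surjective Y
      obtain ⟨Z, rfl⟩ := exp.surjective Z
      simp only [exp_mul_exp]
      congr 1
      ext
      · simp only [HTypeAlgebra.add_fst, HTypeAlgebra.add_snd, HTypeAlgebra.smul_fst,
          HTypeAlgebra.smul_snd, HTypeAlgebra.lie_fst, HTypeAlgebra.lie_snd, smul_zero, add_zero,
          M.pairing_add_left, M.pairing_add_right]
        module
      · simp only [HTypeAlgebra.add_snd, HTypeAlgebra.smul_snd, HTypeAlgebra.lie_snd, smul_zero,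
          add_zero, zero_add, add_assoc])
    (by
      intro X
      obtain ⟨X, rfl⟩ := exp.surjective X
      rw [← exp_zero, exp_mul_exp]
      simp)
    (by
      intro X
      obtain ⟨X, rfl⟩ := exp.surjective X
      rw [← exp_neg, exp_mul_exp, ← exp_zero]
      simp)

end HTypeGroup

/-- Orthonormal bases `z` of `U` and `v` of `V` form an integral basis if the structure constants
`A k i j` in `[v i, v j] = ∑ k, A k i j • z k` all belong to `{0, 1, -1}`. -/
def IsIntegralBasis (M : OrthogonalMultiplication U V) {ι κ : Type*} [Fintype ι] [Fintype κ]
    (z : OrthonormalBasis ι ℝ U) (v : OrthonormalBasis κ ℝ V) : Prop :=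
  ∃ A : ι → κ → κ → ℝ, (∀ k i j, A k i j = 0 ∨ A k i j = 1 ∨ A k i j = -1) ∧
    ∀ i j, ⁅(HTypeAlgebra.mk 0 (v i) : HTypeAlgebra M), HTypeAlgebra.mk 0 (v j)⁆ =
      ∑ k, A k i j • (HTypeAlgebra.mk (z k) 0 : HTypeAlgebra M)

/-- The set of linear combinations with integer coefficients of the elements of a basis. -/
def integerSpan {ι W : Type*} [Fintype ι] [NormedAddCommGroup W] [InnerProductSpace ℝ W]
    (b : OrthonormalBasis ι ℝ W) : AddSubgroup W :=
  AddSubgroup.closure (Set.range b)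

/-- The subset `½ U_ℤ ⊕ V_ℤ` of the H-type group. -/
def hTypeLattice (M : OrthogonalMultiplication U V) {ι κ : Type*} [Fintype ι] [Fintype κ]
    (z : OrthonormalBasis ι ℝ U) (v : OrthonormalBasis κ ℝ V) : Set (HTypeGroup M) :=
  {X | ∃ u ∈ integerSpan z, ∃ w ∈ integerSpan v,
    X = HTypeGroup.exp (HTypeAlgebra.mk ((1 / 2 : ℝ) • u) w)}

/-- The subset `U_ℤ` of the H-type group. -/
def hTypeCenterLattice (M : OrthogonalMultiplication U V) {ι : Type*} [Fintype ι]
    (z : OrthonormalBasis ι ℝ U) : Set (HTypeGroup M) :=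
  {X | ∃ u ∈ integerSpan z, X = HTypeGroup.exp (HTypeAlgebra.mk u 0)}

end HType

/-- A subgroup `Γ` of a topological group is a cocompact lattice if it is discrete and the
quotient by it is compact. -/
def IsCocompactLattice {G : Type*} [Group G] [TopologicalSpace G] (Γ : Subgroup G) : Prop :=
  DiscreteTopology Γ ∧ CompactSpace (G ⧸ Γ)

/-- The Lie algebra of a real Lie group is defined in Mathlib for Lie groups of class
`minSmoothness ℝ 3 = 3`; with this instance it is available for smooth Lie groups. -/
instance instLEInftyMinSmoothness : ENat.LEInfty (minSmoothness ℝ 3) :=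
  ⟨by rw [minSmoothness_of_isRCLikeNormedField]; exact ENat.LEInfty.out⟩

/-- `e` is the exponential map of the Lie group `G` of dimension `d`: for each `X` in the Lie
algebra, the curve `t ↦ e (t X)` is the integral curve through the identity of the left-invariant
vector field defined by `X`. -/
def IsLieExp {d : ℕ} {G : Type*} [TopologicalSpace G] [ChartedSpace (EuclideanSpace ℝ (Fin d)) G]
    [Group G] (e : GroupLieAlgebra (𝓡 d) G → G) : Prop :=
  e 0 = 1 ∧ ∀ X : GroupLieAlgebra (𝓡 d) G,
    IsMIntegralCurve (fun t : ℝ => e (t • X)) (mulInvariantVectorField X)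

/-! Integral bases. Polarization shows that, for an orthonormal basis `z k` of `U`, the maps `J (z
k)` are orthogonal with square `-1` and anticommute. Since `A k i j = (J (z k) (v i), v j)`, it
suffices to find an orthonormal basis of `V` that every `J (z k)` permutes up to sign. The monoid
generated by these maps consists of orthogonal maps with squares `±1`, any two of which commute or
anticommute. In an invariant subspace choose `v ≠ 0` such that the common fixed space of its
stabilizer is minimal. If `g v ≠ ±v` were not orthogonal to `v`, then `g² = 1`, and the stabilizer
of `v + g v` would contain `g` and the stabilizer of `v`, against minimality. So the orbit of `v` is
orthogonal up to sign, and repeating this in orthogonal complements exhausts `V`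
(`IsSignMonoid.exists_orthonormalBasis`).

Lattices. Brackets of `V_ℤ` lie in `U_ℤ`, and the `½` in `L` absorbs the `½` in the product.
Rounding coordinates gives a compact set that meets all cosets. Commutators in `N` are brackets, and
`[v, J z v] = |v|² z` exhibits each `z k` as a commutator of lattice elements.

Lie groups. Left-invariant fields are complete, which gives `exp`. From `d/dt Ad(exp tY) X = Ad(exp
tY) [Y, X]` and uniqueness of integral curves follows the two-step formula `exp X exp Y = exp (X + Y
+ ½[X, Y])` (`lieExp_mul_lieExp`), so `X ↦ exp (φ X)` is a homomorphism from `N`. It matches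
coordinates of the second kind on both groups, where the inverse function theorem applies, hence is
a local homeomorphism at `1`. Then it is a covering with discrete kernel, and the kernel is trivial
because `G` is simply connected. -/

open Filter Topology

/-! ### Second-order calculus of a local multiplication -/

section LocalMultiplication

variable {E : Type*} [NormedAddCommGroup E] [NormedSpace ℝ E]

/-- The derivative of `y ↦ m (x, y)` at `c` in the direction `v`, as a function of `x`: the
left-invariant vector field defined by `v` if `m` is a local multiplication with unit `c`. -/
noncomputable def leftField (m : E × E → E) (c v x : E) : E := fderiv ℝ m (x, c) (0, v)

theorem hasFDerivAt_leftField {m : E × E → E} {c : E} (hm : ContDiffAt ℝ 2 m (c, c)) (v : E) :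
    HasFDerivAt (leftField m c v)
      (((fderiv ℝ (fderiv ℝ m) (c, c)).flip (0, v)).comp (ContinuousLinearMap.inl ℝ E E)) c := by
  have h1 : HasFDerivAt (fderiv ℝ m) (fderiv ℝ (fderiv ℝ m) (c, c)) (c, c) :=
    ((hm.fderiv_right (m := 1) (by norm_num)).differentiableAt (by norm_num)).hasFDerivAt
  have h2 : HasFDerivAt (fun x : E => (x, c)) (ContinuousLinearMap.inl ℝ E E) c :=
    hasFDerivAt_prodMk_left c c
  have h3 := (HasFDerivAt.comp (f := fun x : E => (x, c)) c h1 h2).clm_apply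
    (hasFDerivAt_const ((0 : E), v) c)
  refine h3.congr_fderiv ?_
  ext y
  simp

theorem eventually_differentiableAt_of_contDiffAt_two {F F' : Type*} [NormedAddCommGroup F]
    [NormedSpace ℝ F] [NormedAddCommGroup F'] [NormedSpace ℝ F'] {m : F → F'} {p : F}
    (hm : ContDiffAt ℝ 2 m p) : ∀ᶠ q in 𝓝 p, DifferentiableAt ℝ m q :=
  (hm.eventually (by simp)).mono fun _ h => h.differentiableAt (by norm_num)

theorem fderiv_inl_of_eventually_eq_id {m : E × E → E} {c : E} (hm : DifferentiableAt ℝ m (c, c))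
    (h : ∀ᶠ x in 𝓝 c, m (x, c) = x) (v : E) : fderiv ℝ m (c, c) (v, 0) = v := by
  have h1 := HasFDerivAt.comp (f := fun x : E => (x, c)) c hm.hasFDerivAt
    (hasFDerivAt_prodMk_left (𝕜 := ℝ) c c)
  have h2 : HasFDerivAt (m ∘ fun x => (x, c)) (ContinuousLinearMap.id ℝ E) c :=
    (hasFDerivAt_id c).congr_of_eventuallyEq h
  simpa using DFunLike.congr_fun (h1.unique h2) v

theorem fderiv_inr_of_eventually_eq_id {m : E × E → E} {c : E} (hm : DifferentiableAt ℝ m (c, c))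
    (h : ∀ᶠ x in 𝓝 c, m (c, x) = x) (v : E) : fderiv ℝ m (c, c) (0, v) = v := by
  have h1 := hm.hasFDerivAt.comp c (hasFDerivAt_prodMk_right (𝕜 := ℝ) c c)
  have h2 : HasFDerivAt (m ∘ fun x => (c, x)) (ContinuousLinearMap.id ℝ E) c :=
    (hasFDerivAt_id c).congr_of_eventuallyEq h
  simpa using DFunLike.congr_fun (h1.unique h2) v

/-- If `k` is the conjugation of a local multiplication `m`, then the derivative of the adjoint
action is the commutator of left-invariant vector fields. -/
theorem fderiv_leftField_conj {m k : E × E → E} {c : E} (hm : ContDiffAt ℝ 2 m (c, c))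
    (hk : ContDiffAt ℝ 2 k (c, c)) (hm1 : ∀ᶠ x in 𝓝 c, m (x, c) = x)
    (hk1 : ∀ᶠ x in 𝓝 c, k (x, c) = c) (hk2 : ∀ᶠ y in 𝓝 c, k (c, y) = y)
    (hmk : ∀ᶠ p : E × E in 𝓝 (c, c), m (k p, p.1) = m p) (v w : E) :
    fderiv ℝ (leftField k c v) c w =
      fderiv ℝ (leftField m c v) c w - fderiv ℝ (leftField m c w) c v := by
  have hdm := hm.differentiableAt (by norm_num)
  have hdk := hk.differentiableAt (by norm_num)
  have hDm : HasFDerivAt (fderiv ℝ m) (fderiv ℝ (fderiv ℝ m) (c, c)) (c, c) :=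
    ((hm.fderiv_right (m := 1) (by norm_num)).differentiableAt (by norm_num)).hasFDerivAt
  have hA := (hasFDerivAt_leftField hk v).differentiableAt.hasFDerivAt
  have hAc : leftField k c v c = v := fderiv_inr_of_eventually_eq_id hdk hk2 v
  have hin : Tendsto (fun x : E => (x, c)) (𝓝 c) (𝓝 (c, c)) := by
    have : Continuous (fun x : E => (x, c)) := by fun_prop
    exact this.tendsto c
  have hin' : Tendsto (fun x : E => (c, x)) (𝓝 c) (𝓝 (c, c)) := by
    have : Continuous (fun x : E => (c, x)) := by fun_prop
    exact this.tendsto c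
  -- With `k (x, y) = x y x⁻¹`, differentiate `m (k (x, y), x) = m (x, y)` in `y` at the unit.
  -- Differentiating the result in `x` then produces a mixed second derivative of `m`, and its
  -- symmetry turns it into a derivative of `leftField m c w`.
  have key : ∀ᶠ x in 𝓝 c, fderiv ℝ m (c, x) (leftField k c v x, 0) = leftField m c v x := by
    filter_upwards [hin.eventually (eventually_differentiableAt_of_contDiffAt_two hm),
      hin'.eventually (eventually_differentiableAt_of_contDiffAt_two hm),
      hin.eventually (eventually_differentiableAt_of_contDiffAt_two hk), hk1,
      hin.eventually hmk.eventually_nhds] with x h1 h2 h3 h4 h5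
    have e1 : HasFDerivAt (fun y : E => k (x, y))
        ((fderiv ℝ k (x, c)).comp (ContinuousLinearMap.inr ℝ E E)) c :=
      h3.hasFDerivAt.comp c (hasFDerivAt_prodMk_right x c)
    have e2 := e1.prodMk (hasFDerivAt_const x c)
    have h2' : HasFDerivAt m (fderiv ℝ m (c, x)) (k (x, c), x) := by
      rw [h4]; exact h2.hasFDerivAt
    have e3 := h2'.comp c e2
    have e4 : HasFDerivAt (fun y : E => m (x, y))
        ((fderiv ℝ m (x, c)).comp (ContinuousLinearMap.inr ℝ E E)) c :=
      h1.hasFDerivAt.comp c (hasFDerivAt_prodMk_right x c)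
    have hx : Tendsto (fun y : E => (x, y)) (𝓝 c) (𝓝 (x, c)) := by
      have : Continuous (fun y : E => (x, y)) := by fun_prop
      exact this.tendsto c
    have e5 := e3.unique (e4.congr_of_eventuallyEq (hx.eventually h5))
    simpa [leftField] using DFunLike.congr_fun e5 v
  have hl := (hDm.comp c (hasFDerivAt_prodMk_right (𝕜 := ℝ) c c)).clm_apply
    (hA.prodMk (hasFDerivAt_const (0 : E) c))
  have hr := (hasFDerivAt_leftField hm v).congr_of_eventuallyEq key
  have hh := DFunLike.congr_fun (hl.unique hr) w
  have hsymm := (hm.isSymmSndFDerivAt (by simp)) (0, w) (v, 0)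
  rw [(hasFDerivAt_leftField hm v).fderiv, (hasFDerivAt_leftField hm w).fderiv]
  simp [hAc, fderiv_inl_of_eventually_eq_id hdm hm1] at hh ⊢
  rw [← hh, ← hsymm]
  abel

end LocalMultiplication

/-! ### Maps `G × G → G` in the chart at the identity -/

section ChartExpression

variable {E : Type*} [NormedAddCommGroup E] [NormedSpace ℝ E]
  {G : Type*} [TopologicalSpace G] [ChartedSpace E G] [Group G]

/-- A map `G × G → G` in the preferred chart at `1`. -/
noncomputable def chartExpr (f : G × G → G) (p : E × E) : E :=
  extChartAt 𝓘(ℝ, E) (1 : G)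
    (f ((extChartAt 𝓘(ℝ, E) (1 : G)).symm p.1, (extChartAt 𝓘(ℝ, E) (1 : G)).symm p.2))

variable (E G) in
/-- The coordinates of `1`. -/
noncomputable def chartOne : E := extChartAt 𝓘(ℝ, E) (1 : G) (1 : G)

theorem extChartAt_symm_chartOne :
    (extChartAt 𝓘(ℝ, E) (1 : G)).symm (chartOne E G) = 1 := extChartAt_to_inv _

theorem extChartAt_target_mem_nhds_chartOne :
    (extChartAt 𝓘(ℝ, E) (1 : G)).target ∈ 𝓝 (chartOne E G) := extChartAt_target_mem_nhds _

variable [LieGroup 𝓘(ℝ, E) ∞ G]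

theorem contMDiffAt_extChartAt_symm_chartOne :
    ContMDiffAt 𝓘(ℝ, E) 𝓘(ℝ, E) ∞ (extChartAt 𝓘(ℝ, E) (1 : G)).symm (chartOne E G) :=
  (contMDiffOn_extChartAt_symm (1 : G)).contMDiffAt extChartAt_target_mem_nhds_chartOne

theorem continuousAt_extChartAt_symm_chartOne :
    Tendsto (extChartAt 𝓘(ℝ, E) (1 : G)).symm (𝓝 (chartOne E G)) (𝓝 1) := by
  have h := (contMDiffAt_extChartAt_symm_chartOne (E := E) (G := G)).continuousAt.tendsto
  rwa [extChartAt_symm_chartOne] at h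

theorem contDiffAt_chartExpr {f : G × G → G}
    (hf : ContMDiff (𝓘(ℝ, E).prod 𝓘(ℝ, E)) 𝓘(ℝ, E) ∞ f) (h1 : f (1, 1) = 1) :
    ContDiffAt ℝ ∞ (chartExpr f) (chartOne E G, chartOne E G) := by
  rw [← contMDiffAt_iff_contDiffAt]
  have hs := contMDiffAt_extChartAt_symm_chartOne (E := E) (G := G)
  have h2 : ContMDiffAt 𝓘(ℝ, E × E) 𝓘(ℝ, E) ∞
      (fun p : E × E => (extChartAt 𝓘(ℝ, E) (1 : G)).symm p.1) (chartOne E G, chartOne E G) :=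
    ContMDiffAt.comp (x := (chartOne E G, chartOne E G)) (g := (extChartAt 𝓘(ℝ, E) (1 : G)).symm)
      (f := Prod.fst) hs (contDiff_fst.contMDiff.contMDiffAt)
  have h3 : ContMDiffAt 𝓘(ℝ, E × E) 𝓘(ℝ, E) ∞
      (fun p : E × E => (extChartAt 𝓘(ℝ, E) (1 : G)).symm p.2) (chartOne E G, chartOne E G) :=
    ContMDiffAt.comp (x := (chartOne E G, chartOne E G)) (g := (extChartAt 𝓘(ℝ, E) (1 : G)).symm)
      (f := Prod.snd) hs (contDiff_snd.contMDiff.contMDiffAt)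
  refine ContMDiffAt.comp (x := (chartOne E G, chartOne E G)) (I' := 𝓘(ℝ, E))
    (g := extChartAt 𝓘(ℝ, E) (1 : G)) ?_
    (ContMDiffAt.comp (x := (chartOne E G, chartOne E G)) (g := f) ?_ (h2.prodMk h3))
  · simp only [extChartAt_symm_chartOne, h1]
    exact contMDiffAt_extChartAt
  · exact hf.contMDiffAt

/-- Chain rule for the chart composed with `h ↦ f (g, h)`. It connects calculus in the model space
with derivatives on the manifold, both for the product and for conjugation. -/
theorem leftField_chartExpr {f : G × G → G}
    (hf : ContMDiff (𝓘(ℝ, E).prod 𝓘(ℝ, E)) 𝓘(ℝ, E) ∞ f) (h1 : f (1, 1) = 1) (v : E) :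
    ∀ᶠ x in 𝓝 (chartOne E G), leftField (chartExpr f) (chartOne E G) v x =
      mfderiv 𝓘(ℝ, E) 𝓘(ℝ, E) (extChartAt 𝓘(ℝ, E) (1 : G))
        (f ((extChartAt 𝓘(ℝ, E) (1 : G)).symm x, 1))
        (mfderiv 𝓘(ℝ, E) 𝓘(ℝ, E) (fun h => f ((extChartAt 𝓘(ℝ, E) (1 : G)).symm x, h)) (1 : G)
          v) := by
  have hd := eventually_differentiableAt_of_contDiffAt_two
    ((contDiffAt_chartExpr hf h1).of_le ENat.LEInfty.out)
  have hin : Tendsto (fun x : E => (x, chartOne E G)) (𝓝 (chartOne E G))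
      (𝓝 (chartOne E G, chartOne E G)) := by
    have : Continuous (fun x : E => (x, chartOne E G)) := by fun_prop
    exact this.tendsto _
  have hs : Tendsto (fun x : E => f ((extChartAt 𝓘(ℝ, E) (1 : G)).symm x, 1))
      (𝓝 (chartOne E G)) (𝓝 1) := by
    have h2 := (hf.continuous.tendsto ((1 : G), (1 : G)))
    rw [h1] at h2
    refine h2.comp ?_
    rw [nhds_prod_eq]
    exact continuousAt_extChartAt_symm_chartOne.prodMk tendsto_const_nhds
  filter_upwards [hin.eventually hd, hs.eventually
    ((chartAt E (1 : G)).open_source.mem_nhds (mem_chart_source E (1 : G)))] with x hx hsrc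
  set g := (extChartAt 𝓘(ℝ, E) (1 : G)).symm x with hg
  have hF : MDifferentiableAt 𝓘(ℝ, E) 𝓘(ℝ, E) (fun h => f (g, h)) 1 :=
    ((hf.comp (contMDiff_const.prodMk contMDiff_id)).contMDiffAt
      (x := (1 : G))).mdifferentiableAt (by simp)
  have hψ : MDifferentiableAt 𝓘(ℝ, E) 𝓘(ℝ, E) (extChartAt 𝓘(ℝ, E) (1 : G)) (f (g, 1)) :=
    mdifferentiableAt_extChartAt hsrc
  have e1 := mfderiv_comp (1 : G) (g := extChartAt 𝓘(ℝ, E) (1 : G)) (f := fun h => f (g, h))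
    hψ hF
  have e2 := (MDifferentiableAt.comp (1 : G) (g := extChartAt 𝓘(ℝ, E) (1 : G))
    (f := fun h => f (g, h)) hψ hF).mfderiv
  have e3 : HasFDerivAt (fun y : E => chartExpr f (x, y))
      ((fderiv ℝ (chartExpr f) (x, chartOne E G)).comp (ContinuousLinearMap.inr ℝ E E))
      (chartOne E G) :=
    HasFDerivAt.comp (f := fun y : E => (x, y)) _ hx.hasFDerivAt (hasFDerivAt_prodMk_right x _)
  have e4 : fderivWithin ℝ (writtenInExtChartAt 𝓘(ℝ, E) 𝓘(ℝ, E) (1 : G)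
      ((extChartAt 𝓘(ℝ, E) (1 : G)) ∘ fun h => f (g, h))) (Set.range 𝓘(ℝ, E))
      (extChartAt 𝓘(ℝ, E) (1 : G) 1) =
      (fderiv ℝ (chartExpr f) (x, chartOne E G)).comp (ContinuousLinearMap.inr ℝ E E) := by
    rw [show Set.range 𝓘(ℝ, E) = Set.univ by simp, fderivWithin_univ]
    exact e3.fderiv
  rw [e4] at e2
  have e5 := DFunLike.congr_fun (e2.symm.trans e1) v
  have e6 : leftField (chartExpr f) (chartOne E G) v x =
    ((fderiv ℝ (chartExpr f) (x, chartOne E G)).comp (ContinuousLinearMap.inr ℝ E E)) v := by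
    simp [leftField]
  exact e6.trans e5

end ChartExpression

/-! ### The adjoint action and the Lie bracket in the chart -/

section LieAd

variable {E : Type*} [NormedAddCommGroup E] [NormedSpace ℝ E]
  {G : Type*} [TopologicalSpace G] [ChartedSpace E G] [Group G]

/-- The adjoint action of a Lie group on its Lie algebra. -/
noncomputable def lieAd (g : G) :
    GroupLieAlgebra 𝓘(ℝ, E) G →L[ℝ] GroupLieAlgebra 𝓘(ℝ, E) G :=
  (mfderiv 𝓘(ℝ, E) 𝓘(ℝ, E) (fun h : G => g * h * g⁻¹) 1 : E →L[ℝ] E)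

variable [LieGroup 𝓘(ℝ, E) ∞ G]

theorem contMDiff_mul_uncurry :
    ContMDiff (𝓘(ℝ, E).prod 𝓘(ℝ, E)) 𝓘(ℝ, E) ∞ (fun p : G × G => p.1 * p.2) :=
  contMDiff_mul 𝓘(ℝ, E) ∞

theorem contMDiff_conj_uncurry :
    ContMDiff (𝓘(ℝ, E).prod 𝓘(ℝ, E)) 𝓘(ℝ, E) ∞ (fun p : G × G => p.1 * p.2 * p.1⁻¹) :=
  (contMDiff_mul 𝓘(ℝ, E) ∞).mul contMDiff_fst.inv

theorem contMDiff_conj (g : G) :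
    ContMDiff 𝓘(ℝ, E) 𝓘(ℝ, E) ∞ (fun h : G => g * h * g⁻¹) :=
  contMDiff_conj_uncurry.comp (contMDiff_const.prodMk contMDiff_id)

theorem mdifferentiableAt_conj (g h : G) :
    MDifferentiableAt 𝓘(ℝ, E) 𝓘(ℝ, E) (fun h : G => g * h * g⁻¹) h :=
  (contMDiff_conj g).contMDiffAt.mdifferentiableAt (by simp)

theorem mdifferentiableAt_mul_left' (g h : G) :
    MDifferentiableAt 𝓘(ℝ, E) 𝓘(ℝ, E) (fun h : G => g * h) h :=
  (contMDiff_mul_left (I := 𝓘(ℝ, E)) (n := ∞)).contMDiffAt.mdifferentiableAt (by simp)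

theorem mdifferentiableAt_mul_right' (g h : G) :
    MDifferentiableAt 𝓘(ℝ, E) 𝓘(ℝ, E) (fun h : G => h * g) h :=
  (contMDiff_mul_right (I := 𝓘(ℝ, E)) (n := ∞)).contMDiffAt.mdifferentiableAt (by simp)

/-- The local multiplication in the preferred chart at `1`. -/
noncomputable abbrev chartMul (E G : Type*) [NormedAddCommGroup E] [NormedSpace ℝ E]
    [TopologicalSpace G] [ChartedSpace E G] [Group G] : E × E → E :=
  chartExpr fun p : G × G => p.1 * p.2

/-- The local conjugation in the preferred chart at `1`. -/
noncomputable abbrev chartConj (E G : Type*) [NormedAddCommGroup E] [NormedSpace ℝ E]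
    [TopologicalSpace G] [ChartedSpace E G] [Group G] : E × E → E :=
  chartExpr fun p : G × G => p.1 * p.2 * p.1⁻¹

theorem contDiffAt_chartMul : ContDiffAt ℝ ∞ (chartMul E G) (chartOne E G, chartOne E G) :=
  contDiffAt_chartExpr contMDiff_mul_uncurry (by simp)

theorem contDiffAt_chartConj : ContDiffAt ℝ ∞ (chartConj E G) (chartOne E G, chartOne E G) :=
  contDiffAt_chartExpr contMDiff_conj_uncurry (by simp)

omit [LieGroup 𝓘(ℝ, E) ∞ G] in
theorem chartMul_chartOne_right : ∀ᶠ x in 𝓝 (chartOne E G), chartMul E G (x, chartOne E G) = x := by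
  filter_upwards [extChartAt_target_mem_nhds_chartOne (E := E) (G := G)] with x hx
  simp only [chartMul, chartExpr, extChartAt_symm_chartOne, mul_one]
  exact (extChartAt 𝓘(ℝ, E) (1 : G)).right_inv hx

omit [LieGroup 𝓘(ℝ, E) ∞ G] in
theorem chartConj_chartOne_right (x : E) : chartConj E G (x, chartOne E G) = chartOne E G := by
  simp [chartConj, chartExpr, chartOne]

omit [LieGroup 𝓘(ℝ, E) ∞ G] in
theorem chartConj_chartOne_left :
    ∀ᶠ x in 𝓝 (chartOne E G), chartConj E G (chartOne E G, x) = x := by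
  filter_upwards [extChartAt_target_mem_nhds_chartOne (E := E) (G := G)] with x hx
  simp only [chartConj, chartExpr, extChartAt_symm_chartOne, one_mul, inv_one, mul_one]
  exact (extChartAt 𝓘(ℝ, E) (1 : G)).right_inv hx

theorem chartMul_chartConj : ∀ᶠ p : E × E in 𝓝 (chartOne E G, chartOne E G),
    chartMul E G (chartConj E G p, p.1) = chartMul E G p := by
  have hs : Tendsto (fun p : E × E => (extChartAt 𝓘(ℝ, E) (1 : G)).symm p.1 *
      (extChartAt 𝓘(ℝ, E) (1 : G)).symm p.2 * ((extChartAt 𝓘(ℝ, E) (1 : G)).symm p.1)⁻¹)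
      (𝓝 (chartOne E G, chartOne E G)) (𝓝 1) := by
    have h2 := (contMDiff_conj_uncurry (E := E) (G := G)).continuous.tendsto ((1 : G), (1 : G))
    simp only [mul_one, inv_one] at h2
    rw [nhds_prod_eq] at h2 ⊢
    exact h2.comp
      (continuousAt_extChartAt_symm_chartOne.prodMap continuousAt_extChartAt_symm_chartOne)
  filter_upwards [hs.eventually (extChartAt_source_mem_nhds (I := 𝓘(ℝ, E)) (1 : G))] with p hp
  simp only [chartMul, chartConj, chartExpr]
  rw [(extChartAt 𝓘(ℝ, E) (1 : G)).left_inv hp]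
  simp

theorem leftField_chartMul (v : GroupLieAlgebra 𝓘(ℝ, E) G) :
    ∀ᶠ x in 𝓝 (chartOne E G), leftField (chartMul E G) (chartOne E G) v x =
      mfderiv 𝓘(ℝ, E) 𝓘(ℝ, E) (extChartAt 𝓘(ℝ, E) (1 : G))
        ((extChartAt 𝓘(ℝ, E) (1 : G)).symm x)
        (mulInvariantVectorField v ((extChartAt 𝓘(ℝ, E) (1 : G)).symm x)) := by
  filter_upwards [leftField_chartExpr (contMDiff_mul_uncurry (E := E) (G := G)) (by simp) v]
    with x hx
  rw [hx]
  -- The tangent space depends on its base point, so `g * 1 = g` is used by substitution in a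
  -- general statement, with vectors regarded in the model space.
  have key : ∀ g h : G, g = h → ∀ w : E,
      (mfderiv 𝓘(ℝ, E) 𝓘(ℝ, E) (extChartAt 𝓘(ℝ, E) (1 : G)) g : E →L[ℝ] E) w =
      (mfderiv 𝓘(ℝ, E) 𝓘(ℝ, E) (extChartAt 𝓘(ℝ, E) (1 : G)) h : E →L[ℝ] E) w := by
    rintro g h rfl w
    rfl
  exact key _ _ (mul_one _) _

/-- Conjugation fixes `1`, where the derivative of the preferred chart is the identity, so no chart
derivative remains in the formula. -/
theorem leftField_chartConj (v : GroupLieAlgebra 𝓘(ℝ, E) G) :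
    ∀ᶠ x in 𝓝 (chartOne E G), leftField (chartConj E G) (chartOne E G) v x =
      lieAd ((extChartAt 𝓘(ℝ, E) (1 : G)).symm x) v := by
  filter_upwards [leftField_chartExpr (contMDiff_conj_uncurry (E := E) (G := G)) (by simp) v]
    with x hx
  rw [hx]
  have h : (extChartAt 𝓘(ℝ, E) (1 : G)).symm x * 1 *
      ((extChartAt 𝓘(ℝ, E) (1 : G)).symm x)⁻¹ = 1 := by
    simp
  have key : ∀ g : G, g = 1 → ∀ w : E,
      (mfderiv 𝓘(ℝ, E) 𝓘(ℝ, E) (extChartAt 𝓘(ℝ, E) (1 : G)) g : E →L[ℝ] E) w = w := by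
    rintro g rfl w
    rw [mfderiv_extChartAt_self]
    rfl
  exact key _ h _

/-- The bracket of left-invariant fields is computed in the chart at `1`, where these fields become
`leftField`. Together with `fderiv_leftField_conj` this identifies the bracket with the derivative
of `Ad`. -/
theorem bracket_eq_leftField [CompleteSpace E] (v w : GroupLieAlgebra 𝓘(ℝ, E) G) :
    ⁅v, w⁆ = (fderiv ℝ (leftField (chartMul E G) (chartOne E G) w) (chartOne E G) v -
      fderiv ℝ (leftField (chartMul E G) (chartOne E G) v) (chartOne E G) w : E) := by
  have hv1 : ∀ v : E, leftField (chartMul E G) (chartOne E G) v (chartOne E G) = v := fun v =>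
    fderiv_inr_of_eventually_eq_id ((contDiffAt_chartMul (E := E) (G := G)).differentiableAt
      (by simp)) (by
      filter_upwards [extChartAt_target_mem_nhds_chartOne (E := E) (G := G)] with x hx
      simp only [chartMul, chartExpr, extChartAt_symm_chartOne, one_mul]
      exact (extChartAt 𝓘(ℝ, E) (1 : G)).right_inv hx) v
  have hV : ∀ v : GroupLieAlgebra 𝓘(ℝ, E) G,
      VectorField.mpullbackWithin 𝓘(ℝ, E) 𝓘(ℝ, E) (extChartAt 𝓘(ℝ, E) (1 : G)).symm
        (mulInvariantVectorField v) (Set.range 𝓘(ℝ, E)) =ᶠ[𝓝 (chartOne E G)]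
      leftField (chartMul E G) (chartOne E G) v := by
    intro v
    filter_upwards [leftField_chartMul v, extChartAt_target_mem_nhds_chartOne (E := E) (G := G)]
      with x hx hx'
    rw [hx, VectorField.mpullbackWithin_apply]
    rw [ContinuousLinearMap.inverse_eq
      (mfderivWithin_extChartAt_symm_comp_mfderiv_extChartAt (I := 𝓘(ℝ, E)) hx')
      (mfderiv_extChartAt_comp_mfderivWithin_extChartAt_symm (I := 𝓘(ℝ, E)) hx')]
    rfl
  rw [GroupLieAlgebra.bracket_def, ← VectorField.mlieBracketWithin_univ,
    VectorField.mlieBracketWithin_apply, mfderiv_extChartAt_self]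
  have e1 : ∀ x : E, (ContinuousLinearMap.id ℝ E).inverse x = x := by simp
  refine (e1 _).trans ?_
  simp only [Set.preimage_univ, Set.univ_inter]
  rw [show Set.range 𝓘(ℝ, E) = Set.univ by simp] at *
  refine (congrFun (VectorField.lieBracketWithin_univ (𝕜 := ℝ) (E := E)) _).trans ?_
  have e2 := (hV v).lieBracket_vectorField_eq (hV w) (𝕜 := ℝ)
  refine e2.trans ?_
  exact congrArg₂ (fun a b : E => a - b) (congrArg _ (hv1 v)) (congrArg _ (hv1 w))

end LieAd

/-! ### Left logarithmic derivatives of curves -/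

section LeftDerivative

variable {E : Type*} [NormedAddCommGroup E] [NormedSpace ℝ E]
  {G : Type*} [TopologicalSpace G] [ChartedSpace E G] [Group G]

/-- The curve `γ` in a Lie group has left logarithmic derivative `X` at `t`. -/
def HasLeftDerivAt (γ : ℝ → G) (X : GroupLieAlgebra 𝓘(ℝ, E) G) (t : ℝ) : Prop :=
  HasMFDerivAt 𝓘(ℝ, ℝ) 𝓘(ℝ, E) γ t
    ((1 : ℝ →L[ℝ] ℝ).smulRight (mulInvariantVectorField X (γ t)))

theorem hasMFDerivAt_of_point_eq {M N : Type*} [TopologicalSpace M] [ChartedSpace E M]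
    [TopologicalSpace N] [ChartedSpace E N] {f : M → N} {x y : M} (h : x = y) (L : E →L[ℝ] E)
    (hf : HasMFDerivAt 𝓘(ℝ, E) 𝓘(ℝ, E) f y L) : HasMFDerivAt 𝓘(ℝ, E) 𝓘(ℝ, E) f x L := by
  subst h
  exact hf

variable [LieGroup 𝓘(ℝ, E) ∞ G]

theorem hasMFDerivAt_conj (g : G) :
    HasMFDerivAt 𝓘(ℝ, E) 𝓘(ℝ, E) (fun h : G => g * h * g⁻¹) 1 (lieAd g : E →L[ℝ] E) :=
  (mdifferentiableAt_conj g 1).hasMFDerivAt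

theorem lieAd_one : lieAd (1 : G) = ContinuousLinearMap.id ℝ (GroupLieAlgebra 𝓘(ℝ, E) G) := by
  have h1 := hasMFDerivAt_conj (E := E) (1 : G)
  have h2 : HasMFDerivAt 𝓘(ℝ, E) 𝓘(ℝ, E) (fun h : G => 1 * h * 1⁻¹) 1
      (ContinuousLinearMap.id ℝ E) := by
    have : (fun h : G => 1 * h * 1⁻¹) = id := by ext; simp
    rw [this]
    exact hasMFDerivAt_id _
  exact hasMFDerivAt_unique h1 h2

theorem lieAd_mul (g h : G) (X : GroupLieAlgebra 𝓘(ℝ, E) G) :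
    lieAd (g * h) X = lieAd g (lieAd h X) := by
  have h1 := hasMFDerivAt_conj (E := E) h
  have h2 := hasMFDerivAt_of_point_eq (show h * 1 * h⁻¹ = 1 by simp) _
    (hasMFDerivAt_conj (E := E) g)
  have h3 := HasMFDerivAt.comp (1 : G) (f := fun x : G => h * x * h⁻¹) h2 h1
  have h4 := hasMFDerivAt_conj (E := E) (g * h)
  have h5 : (fun x : G => g * x * g⁻¹) ∘ (fun x : G => h * x * h⁻¹) =
      fun x : G => g * h * x * (g * h)⁻¹ := by ext; simp [mul_assoc]
  rw [h5] at h3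
  exact DFunLike.congr_fun (hasMFDerivAt_unique h4 h3) X

theorem hasMFDerivAt_mul_left' (g h : G) :
    HasMFDerivAt 𝓘(ℝ, E) 𝓘(ℝ, E) (fun x : G => g * x) h
      (mfderiv 𝓘(ℝ, E) 𝓘(ℝ, E) (fun x : G => g * x) h) :=
  (mdifferentiableAt_mul_left' g h).hasMFDerivAt

theorem hasMFDerivAt_mul_right' (g h : G) :
    HasMFDerivAt 𝓘(ℝ, E) 𝓘(ℝ, E) (fun x : G => x * g) h
      (mfderiv 𝓘(ℝ, E) 𝓘(ℝ, E) (fun x : G => x * g) h) :=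
  (mdifferentiableAt_mul_right' g h).hasMFDerivAt

/-- Left translation preserves left-invariant vector fields. -/
theorem mfderiv_mul_left_mulInvariantVectorField (g h : G) (X : GroupLieAlgebra 𝓘(ℝ, E) G) :
    (mfderiv 𝓘(ℝ, E) 𝓘(ℝ, E) (fun x : G => g * x) h : E →L[ℝ] E) (mulInvariantVectorField X h) =
      mulInvariantVectorField X (g * h) := by
  have h1 := hasMFDerivAt_mul_left' (E := E) h 1
  have h2 := hasMFDerivAt_of_point_eq (mul_one h) _ (hasMFDerivAt_mul_left' (E := E) g h)
  have h3 := HasMFDerivAt.comp (1 : G) (f := fun x : G => h * x) h2 h1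
  have h4 : (fun x : G => g * x) ∘ (fun x : G => h * x) = fun x : G => g * h * x := by
    ext; simp [mul_assoc]
  rw [h4] at h3
  exact (DFunLike.congr_fun (hasMFDerivAt_unique (hasMFDerivAt_mul_left' (E := E) (g * h) 1) h3)
    X).symm

/-- Right translation transforms left-invariant vector fields by the adjoint action. -/
theorem mfderiv_mul_right_mulInvariantVectorField (g h : G) (X : GroupLieAlgebra 𝓘(ℝ, E) G) :
    (mfderiv 𝓘(ℝ, E) 𝓘(ℝ, E) (fun x : G => x * h) g : E →L[ℝ] E) (mulInvariantVectorField X g) =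
      mulInvariantVectorField (lieAd h⁻¹ X) (g * h) := by
  have h1 := hasMFDerivAt_mul_left' (E := E) g 1
  have h2 := hasMFDerivAt_of_point_eq (mul_one g) _ (hasMFDerivAt_mul_right' (E := E) h g)
  have h3 := HasMFDerivAt.comp (1 : G) (f := fun x : G => g * x) h2 h1
  have h1' := hasMFDerivAt_conj (E := E) h⁻¹
  have h2' := hasMFDerivAt_of_point_eq (show h⁻¹ * 1 * h⁻¹⁻¹ = 1 by simp) _
    (hasMFDerivAt_mul_left' (E := E) (g * h) 1)
  have h3' := HasMFDerivAt.comp (1 : G) (f := fun x : G => h⁻¹ * x * h⁻¹⁻¹) h2' h1'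
  have h4 : (fun x : G => x * h) ∘ (fun x : G => g * x) =
      (fun x : G => g * h * x) ∘ (fun x : G => h⁻¹ * x * h⁻¹⁻¹) := by
    ext; simp [mul_assoc]
  rw [h4] at h3
  exact DFunLike.congr_fun (hasMFDerivAt_unique h3 h3') X

/-- In the product rule, left translation by `γ t` preserves left-invariant fields, while right
translation by `δ t` twists them by `Ad (δ t)⁻¹`. -/
theorem HasLeftDerivAt.mul {γ δ : ℝ → G} {X Y : GroupLieAlgebra 𝓘(ℝ, E) G} {t : ℝ}
    (hγ : HasLeftDerivAt γ X t) (hδ : HasLeftDerivAt δ Y t) :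
    HasLeftDerivAt (fun s => γ s * δ s) (lieAd (δ t)⁻¹ X + Y) t := by
  have hm : MDifferentiableAt (𝓘(ℝ, E).prod 𝓘(ℝ, E)) 𝓘(ℝ, E) (fun p : G × G => p.1 * p.2)
      (γ t, δ t) := contMDiff_mul_uncurry.contMDiffAt.mdifferentiableAt (by simp)
  have h := HasMFDerivAt.comp t (f := fun s => (γ s, δ s)) hm.hasMFDerivAt (hγ.prodMk hδ)
  refine HasMFDerivAt.congr_mfderiv h ?_
  refine ContinuousLinearMap.ext_ring ?_
  let a : E := mulInvariantVectorField X (γ t)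
  let b : E := mulInvariantVectorField Y (δ t)
  have e := mfderiv_prod_eq_add_apply (E := E) (E' := E) (v := ((a, b) : E × E)) hm
  have e1 := mfderiv_mul_right_mulInvariantVectorField (γ t) (δ t) X
  have e2 := mfderiv_mul_left_mulInvariantVectorField (γ t) (δ t) Y
  have e3 := congrFun (mulInvariantVectorField_add (lieAd (δ t)⁻¹ X) Y) (γ t * δ t)
  let c : E := mulInvariantVectorField (lieAd (δ t)⁻¹ X + Y) (γ t * δ t)
  have e4 : ((mfderiv (𝓘(ℝ, E).prod 𝓘(ℝ, E)) 𝓘(ℝ, E) (fun p : G × G => p.1 * p.2)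
      (γ t, δ t) : E × E →L[ℝ] E) ((1 : ℝ) • a, (1 : ℝ) • b)) = (1 : ℝ) • c := by
    rw [one_smul, one_smul, one_smul]
    exact e.trans ((congrArg₂ (fun a b : E => a + b) e1 e2).trans e3.symm)
  exact e4

omit [LieGroup 𝓘(ℝ, E) ∞ G] in
theorem hasLeftDerivAt_const (g : G) (t : ℝ) :
    HasLeftDerivAt (fun _ => g) (0 : GroupLieAlgebra 𝓘(ℝ, E) G) t := by
  refine HasMFDerivAt.congr_mfderiv (hasMFDerivAt_const g t) ?_
  refine ContinuousLinearMap.ext_ring ?_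
  have e : (mulInvariantVectorField (0 : GroupLieAlgebra 𝓘(ℝ, E) G) g : E) = 0 :=
    (mfderiv 𝓘(ℝ, E) 𝓘(ℝ, E) (fun x : G => g * x) 1 : E →L[ℝ] E).map_zero
  have e4 : (0 : E) =
      (1 : ℝ) • (mulInvariantVectorField (0 : GroupLieAlgebra 𝓘(ℝ, E) G) g : E) := by
    rw [e, smul_zero]
    rfl
  exact e4

theorem HasLeftDerivAt.const_mul {γ : ℝ → G} {X : GroupLieAlgebra 𝓘(ℝ, E) G} {t : ℝ}
    (hγ : HasLeftDerivAt γ X t) (g : G) : HasLeftDerivAt (fun s => g * γ s) X t := by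
  have h := (hasLeftDerivAt_const (E := E) g t).mul hγ
  rwa [map_zero, zero_add] at h

omit [LieGroup 𝓘(ℝ, E) ∞ G] in
theorem HasLeftDerivAt.comp {γ : ℝ → G} {X : GroupLieAlgebra 𝓘(ℝ, E) G} {t : ℝ} {u : ℝ → ℝ}
    {a : ℝ} (hγ : HasLeftDerivAt γ X (u t)) (hu : HasDerivAt u a t) :
    HasLeftDerivAt (fun s => γ (u s)) (a • X) t := by
  have h := HasMFDerivAt.comp t (f := u) hγ hu.hasFDerivAt.hasMFDerivAt
  refine HasMFDerivAt.congr_mfderiv h ?_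
  refine ContinuousLinearMap.ext_ring ?_
  have e := congrFun (mulInvariantVectorField_smul a X) (γ (u t))
  let b : E := mulInvariantVectorField X (γ (u t))
  let c : E := mulInvariantVectorField (a • X) (γ (u t))
  have e4 : (1 * a : ℝ) • b = (1 : ℝ) • c := by
    rw [one_mul, one_smul]
    exact e.symm
  exact e4

end LeftDerivative

/-! ### The exponential map of a Lie group -/

section LieExp

variable {E : Type*} [NormedAddCommGroup E] [NormedSpace ℝ E] [CompleteSpace E]
  {G : Type*} [TopologicalSpace G] [T2Space G] [ChartedSpace E G] [Group G]
  [LieGroup 𝓘(ℝ, E) ∞ G]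

omit [CompleteSpace E] [T2Space G] in
theorem contMDiff_one_mulInvariantVectorField (X : GroupLieAlgebra 𝓘(ℝ, E) G) :
    ContMDiff 𝓘(ℝ, E) 𝓘(ℝ, E).tangent 1
      (fun g : G => (⟨g, mulInvariantVectorField X g⟩ : TangentBundle 𝓘(ℝ, E) G)) := by
  refine (contMDiff_mulInvariantVectorField X).of_le ?_
  rw [minSmoothness_of_isRCLikeNormedField]
  norm_num

/-- Left-invariant vector fields are complete. -/
theorem exists_isMIntegralCurve_mulInvariantVectorField (X : GroupLieAlgebra 𝓘(ℝ, E) G) :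
    ∃ γ : ℝ → G, γ 0 = 1 ∧ IsMIntegralCurve γ (mulInvariantVectorField X) := by
  obtain ⟨γ, h0, hγ⟩ := exists_isMIntegralCurveAt_of_contMDiffAt_boundaryless 0
    (contMDiff_one_mulInvariantVectorField X).contMDiffAt (x₀ := (1 : G))
  obtain ⟨ε, hε, h⟩ := isMIntegralCurveAt_iff'.mp hγ
  -- Left translates of a single local solution through `1` start at every point and live on the
  -- same interval; this uniform existence time makes the field complete.
  refine exists_isMIntegralCurve_of_isMIntegralCurveOn (contMDiff_one_mulInvariantVectorField X)
    hε (fun g => ⟨fun t => g * γ t, by simp [h0], ?_⟩) 1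
  intro t ht
  rw [← Real.ball_zero_eq_Ioo] at ht
  have h1 : HasLeftDerivAt γ X t := (h t ht).hasMFDerivAt (Metric.isOpen_ball.mem_nhds ht)
  exact HasMFDerivAt.hasMFDerivWithinAt (h1.const_mul g)

omit [CompleteSpace E] in
-- This uniqueness is the tool for identities between exponentials: both sides are compared through
-- their left derivatives and their values at `0`.
theorem isMIntegralCurve_mulInvariantVectorField_eq {X : GroupLieAlgebra 𝓘(ℝ, E) G}
    {γ δ : ℝ → G} (hγ : ∀ t, HasLeftDerivAt γ X t) (hδ : ∀ t, HasLeftDerivAt δ X t)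
    (h : γ 0 = δ 0) : γ = δ :=
  isMIntegralCurve_Ioo_eq_of_contMDiff_boundaryless (contMDiff_one_mulInvariantVectorField X)
    hγ hδ h

variable (E G) in
theorem exists_lieExp : ∃ e : GroupLieAlgebra 𝓘(ℝ, E) G → G, e 0 = 1 ∧
    ∀ X t, HasLeftDerivAt (fun t : ℝ => e (t • X)) X t := by
  choose γ h0 hγ using exists_isMIntegralCurve_mulInvariantVectorField (E := E) (G := G)
  -- Rescaling time turns the curve of `X` into that of `t • X`, so the time-one map recovers each
  -- whole curve.
  have key : ∀ X t, γ (t • X) 1 = γ X t := by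
    intro X t
    have h1 : ∀ s, HasLeftDerivAt (fun s => γ X (s * t)) (t • X) s := fun s =>
      HasLeftDerivAt.comp (hγ X (s * t)) (by simpa using (hasDerivAt_id s).mul_const t)
    have h2 := isMIntegralCurve_mulInvariantVectorField_eq (hγ (t • X)) h1 (by simp [h0])
    simpa using congrFun h2 1
  refine ⟨fun X => γ X 1, ?_, fun X t => ?_⟩
  · have := key 0 0
    rw [zero_smul, h0] at this
    exact this
  · simp only [key]
    exact hγ X t

section

variable {e : GroupLieAlgebra 𝓘(ℝ, E) G → G} (he0 : e 0 = 1)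
  (he : ∀ X t, HasLeftDerivAt (fun t : ℝ => e (t • X)) X t)
include he0 he

omit [CompleteSpace E] in
theorem lieExp_add_smul (X : GroupLieAlgebra 𝓘(ℝ, E) G) (s t : ℝ) :
    e ((s + t) • X) = e (s • X) * e (t • X) := by
  have h1 : ∀ t, HasLeftDerivAt (fun t => e ((s + t) • X)) X t := by
    intro t
    have := HasLeftDerivAt.comp (u := fun t => s + t) (he X (s + t))
      ((hasDerivAt_id t).const_add s)
    rwa [one_smul] at this
  have h2 : ∀ t, HasLeftDerivAt (fun t => e (s • X) * e (t • X)) X t := fun t =>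
    (he X t).const_mul _
  exact congrFun (isMIntegralCurve_mulInvariantVectorField_eq h1 h2 (by simp [he0])) t

omit [CompleteSpace E] in
theorem lieExp_neg (X : GroupLieAlgebra 𝓘(ℝ, E) G) : e (-X) = (e X)⁻¹ := by
  have h := lieExp_add_smul he0 he X (-1) 1
  rw [neg_add_cancel, zero_smul, he0, neg_one_smul, one_smul] at h
  exact eq_inv_of_mul_eq_one_left h.symm

omit [CompleteSpace E] [T2Space G] in
-- In the chart, a one-parameter subgroup solves the ordinary differential equation of the field
-- `leftField`, as long as it stays near `1`.
theorem eventually_hasDerivAt_extChartAt_lieExp (X : GroupLieAlgebra 𝓘(ℝ, E) G) :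
    ∀ᶠ t in 𝓝 (0 : ℝ), HasDerivAt (fun t : ℝ => extChartAt 𝓘(ℝ, E) (1 : G) (e (t • X)))
      (leftField (chartMul E G) (chartOne E G) X (extChartAt 𝓘(ℝ, E) (1 : G) (e (t • X)))) t := by
  have hc : Tendsto (fun t : ℝ => e (t • X)) (𝓝 0) (𝓝 1) := by
    have := (he X 0).1.tendsto
    simpa [he0] using this
  have hc' : Tendsto (fun t : ℝ => extChartAt 𝓘(ℝ, E) (1 : G) (e (t • X))) (𝓝 0)
      (𝓝 (chartOne E G)) :=
    (continuousAt_extChartAt (I := 𝓘(ℝ, E)) (1 : G)).tendsto.comp hc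
  filter_upwards [hc.eventually (extChartAt_source_mem_nhds (I := 𝓘(ℝ, E)) (1 : G)),
    hc'.eventually (leftField_chartMul X)] with t ht ht'
  rw [ht']
  have hl := (extChartAt 𝓘(ℝ, E) (1 : G)).left_inv ht
  have h1 : MDifferentiableAt 𝓘(ℝ, E) 𝓘(ℝ, E) (extChartAt 𝓘(ℝ, E) (1 : G)) (e (t • X)) :=
    mdifferentiableAt_extChartAt (by rwa [extChartAt_source] at ht)
  have h2 := HasMFDerivAt.comp t (f := fun t : ℝ => e (t • X)) h1.hasMFDerivAt (he X t)
  let a : E := mulInvariantVectorField X (e (t • X))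
  let D : E →L[ℝ] E := mfderiv 𝓘(ℝ, E) 𝓘(ℝ, E) (extChartAt 𝓘(ℝ, E) (1 : G)) (e (t • X))
  have h3 : HasFDerivAt (fun t : ℝ => extChartAt 𝓘(ℝ, E) (1 : G) (e (t • X)))
      (D.comp ((1 : ℝ →L[ℝ] ℝ).smulRight a)) t := hasMFDerivAt_iff_hasFDerivAt.mp h2
  have h4 := h3.hasDerivAt
  have key : ∀ g h : G, g = h →
      (mfderiv 𝓘(ℝ, E) 𝓘(ℝ, E) (extChartAt 𝓘(ℝ, E) (1 : G)) g : E →L[ℝ] E)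
        (mulInvariantVectorField X g) =
      (mfderiv 𝓘(ℝ, E) 𝓘(ℝ, E) (extChartAt 𝓘(ℝ, E) (1 : G)) h : E →L[ℝ] E)
        (mulInvariantVectorField X h) := by
    rintro g h rfl
    rfl
  have h5 := key _ _ hl
  refine h4.congr_deriv (Eq.trans ?_ h5.symm)
  have h6 : D ((1 : ℝ) • a) = D a := by rw [one_smul]
  exact h6

end

end LieExp

/-! ### The derivative of `Ad` and the two-step Baker-Campbell-Hausdorff formula -/

section TwoStep

variable {E : Type*} [NormedAddCommGroup E] [NormedSpace ℝ E] [CompleteSpace E]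
  {G : Type*} [TopologicalSpace G] [T2Space G] [ChartedSpace E G] [Group G]
  [LieGroup 𝓘(ℝ, E) ∞ G]
  {e : GroupLieAlgebra 𝓘(ℝ, E) G → G} (he0 : e 0 = 1)
  (he : ∀ X t, HasLeftDerivAt (fun t : ℝ => e (t • X)) X t)
/-- The adjoint action, as an endomorphism of the model space. -/
noncomputable def lieAdModel (g : G) : E →L[ℝ] E :=
  (lieAd g : GroupLieAlgebra 𝓘(ℝ, E) G →L[ℝ] GroupLieAlgebra 𝓘(ℝ, E) G)

/-- The bracket, as an element of the model space. -/
noncomputable def bracketModel (X Y : GroupLieAlgebra 𝓘(ℝ, E) G) : E :=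
  (⁅X, Y⁆ : GroupLieAlgebra 𝓘(ℝ, E) G)

include he0 he

omit [CompleteSpace E] [T2Space G] in
theorem hasDerivAt_extChartAt_lieExp (X : GroupLieAlgebra 𝓘(ℝ, E) G) :
    HasDerivAt (fun t : ℝ => extChartAt 𝓘(ℝ, E) (1 : G) (e (t • X))) (X : E) 0 := by
  have h := (eventually_hasDerivAt_extChartAt_lieExp he0 he X).self_of_nhds
  have h1 : leftField (chartMul E G) (chartOne E G) X
      (extChartAt 𝓘(ℝ, E) (1 : G) (e ((0 : ℝ) • X))) = X := by
    rw [zero_smul, he0]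
    refine fderiv_inr_of_eventually_eq_id ((contDiffAt_chartMul (E := E) (G := G)).differentiableAt
      (by simp)) ?_ X
    filter_upwards [extChartAt_target_mem_nhds_chartOne (E := E) (G := G)] with x hx
    simp only [chartMul, chartExpr, extChartAt_symm_chartOne, one_mul]
    exact (extChartAt 𝓘(ℝ, E) (1 : G)).right_inv hx
  exact h.congr_deriv h1

omit [T2Space G] in
theorem hasDerivAt_lieAd_zero (X Y : GroupLieAlgebra 𝓘(ℝ, E) G) :
    HasDerivAt (fun t : ℝ => lieAdModel (E := E) (e (t • Y)) X) (bracketModel Y X) 0 := by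
  have hconj : ContDiffAt ℝ 2 (chartConj E G) (chartOne E G, chartOne E G) :=
    contDiffAt_chartConj.of_le ENat.LEInfty.out
  have hmul : ContDiffAt ℝ 2 (chartMul E G) (chartOne E G, chartOne E G) :=
    contDiffAt_chartMul.of_le ENat.LEInfty.out
  have h1 := (hasFDerivAt_leftField hconj X).differentiableAt.hasFDerivAt
  have h2 := fderiv_leftField_conj hmul hconj chartMul_chartOne_right
    (Eventually.of_forall chartConj_chartOne_right) chartConj_chartOne_left chartMul_chartConj X Y
  have hψ := hasDerivAt_extChartAt_lieExp he0 he Y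
  have h0 : extChartAt 𝓘(ℝ, E) (1 : G) (e ((0 : ℝ) • Y)) = chartOne E G := by
    rw [zero_smul, he0]; rfl
  rw [← h0] at h1
  have h3 := h1.comp_hasDerivAt (0 : ℝ) hψ
  rw [h0, h2] at h3
  have hc : Tendsto (fun t : ℝ => e (t • Y)) (𝓝 0) (𝓝 1) := by
    have := (he Y 0).1.tendsto
    simpa [he0] using this
  have hc' : Tendsto (fun t : ℝ => extChartAt 𝓘(ℝ, E) (1 : G) (e (t • Y))) (𝓝 0)
      (𝓝 (chartOne E G)) :=
    (continuousAt_extChartAt (I := 𝓘(ℝ, E)) (1 : G)).tendsto.comp hc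
  refine (h3.congr_of_eventuallyEq ?_).congr_deriv (bracket_eq_leftField Y X).symm
  filter_upwards [hc.eventually (extChartAt_source_mem_nhds (I := 𝓘(ℝ, E)) (1 : G)),
    hc'.eventually (leftField_chartConj X)] with t ht ht'
  refine Eq.trans ?_ ht'.symm
  rw [(extChartAt 𝓘(ℝ, E) (1 : G)).left_inv ht]
  rfl

/-- The case `t = 0` is transported by the factorization `Ad (e (s Y)) = Ad (e (t Y)) Ad (e ((s - t)
Y))`. -/
theorem hasDerivAt_lieAd (X Y : GroupLieAlgebra 𝓘(ℝ, E) G) (t : ℝ) :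
    HasDerivAt (fun t : ℝ => lieAdModel (E := E) (e (t • Y)) X)
      (lieAdModel (E := E) (e (t • Y)) (bracketModel Y X)) t := by
  have h1 := hasDerivAt_lieAd_zero he0 he X Y
  have h2 := (lieAdModel (E := E) (e (t • Y))).hasFDerivAt.comp_hasDerivAt (0 : ℝ) h1
  have h3 : HasDerivAt (fun s : ℝ => s - t) 1 t := (hasDerivAt_id t).sub_const t
  have h4 := HasDerivAt.scomp_of_eq (h := fun s : ℝ => s - t) t h2 h3 (by simp)
  refine (h4.congr_deriv (one_smul _ _)).congr_of_eventuallyEq (Eventually.of_forall fun s => ?_)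
  have h5 : e (s • Y) = e (t • Y) * e ((s - t) • Y) := by
    rw [← lieExp_add_smul he0 he]; simp
  show lieAd (e (s • Y)) X = lieAd (e (t • Y)) (lieAd (e ((s - t) • Y)) X)
  rw [h5, lieAd_mul]

theorem lieAd_lieExp_of_bracket_eq_zero {X Y : GroupLieAlgebra 𝓘(ℝ, E) G} (h : ⁅Y, X⁆ = 0) :
    lieAd (e Y) X = X := by
  have h1 : ∀ t, HasDerivAt (fun t : ℝ => lieAdModel (E := E) (e (t • Y)) X) 0 t := by
    intro t
    refine (hasDerivAt_lieAd he0 he X Y t).congr_deriv ?_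
    rw [bracketModel, h]
    exact (lieAdModel (E := E) (e (t • Y))).map_zero
  have h2 := is_const_of_deriv_eq_zero (fun t => (h1 t).differentiableAt)
    (fun t => (h1 t).deriv) 1 0
  simp only [one_smul, zero_smul, he0, lieAdModel, lieAd_one] at h2
  exact h2

/-- The derivative `Ad (e (t Y)) [Y, X]` is constantly `[Y, X]`, since `Y` commutes with `[Y, X]`;
so the curve is affine in `t`. -/
theorem lieAd_lieExp_of_bracket_bracket_eq_zero {X Y : GroupLieAlgebra 𝓘(ℝ, E) G}
    (h : ⁅Y, ⁅Y, X⁆⁆ = 0) (t : ℝ) : lieAd (e (t • Y)) X = X + t • ⁅Y, X⁆ := by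
  let W : E := bracketModel Y X
  have h1 : ∀ t, HasDerivAt (fun t : ℝ => lieAdModel (E := E) (e (t • Y)) X - t • W) 0 t := by
    intro t
    have h2 := (hasDerivAt_lieAd he0 he X Y t).sub ((hasDerivAt_id t).smul_const W)
    refine h2.congr_deriv ?_
    have h3 : lieAd (e (t • Y)) ⁅Y, X⁆ = ⁅Y, X⁆ :=
      lieAd_lieExp_of_bracket_eq_zero he0 he (by rw [smul_lie, h, smul_zero])
    rw [one_smul]
    exact sub_eq_zero.mpr h3
  have h2 := is_const_of_deriv_eq_zero (fun t => (h1 t).differentiableAt)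
    (fun t => (h1 t).deriv) t 0
  simp only [zero_smul, he0, lieAdModel, lieAd_one, sub_zero] at h2
  exact (sub_eq_iff_eq_add (G := E)).mp h2

/-- The Baker-Campbell-Hausdorff formula in a two-step nilpotent Lie group. -/
theorem lieExp_mul_lieExp (hnil : ∀ X Y Z : GroupLieAlgebra 𝓘(ℝ, E) G, ⁅⁅X, Y⁆, Z⁆ = 0)
    (X Y : GroupLieAlgebra 𝓘(ℝ, E) G) :
    e X * e Y = e (X + Y + (1 / 2 : ℝ) • ⁅X, Y⁆) := by
  have hnil' : ∀ X Y Z : GroupLieAlgebra 𝓘(ℝ, E) G, ⁅Z, ⁅X, Y⁆⁆ = 0 := fun X Y Z => by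
    rw [← lie_skew, hnil, neg_zero]
  -- The left derivative of the first two factors is `X + t[X, Y] + Y`. The central third factor
  -- contributes `-t[X, Y]`, which leaves the constant `X + Y`.
  have hc : ∀ (X Y : GroupLieAlgebra 𝓘(ℝ, E) G) (t : ℝ),
      e (t • X) * e (t • Y) * e ((-(t ^ 2 / 2)) • ⁅X, Y⁆) = e (t • (X + Y)) := by
    intro X Y
    refine congrFun (isMIntegralCurve_mulInvariantVectorField_eq (X := X + Y) (fun t => ?_)
      (he (X + Y)) (by simp [he0]))
    have h1 := (he X t).mul (he Y t)
    have h2 : HasDerivAt (fun t : ℝ => -(t ^ 2 / 2)) (-t) t := by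
      have := (((hasDerivAt_id t).pow 2).div_const 2).neg
      refine this.congr_deriv ?_
      simp
    have h3 := h1.mul (HasLeftDerivAt.comp (he ⁅X, Y⁆ (-(t ^ 2 / 2))) h2)
    convert h3 using 1
    have hA : lieAd (e (t • Y))⁻¹ X = X + t • ⁅X, Y⁆ := by
      rw [← lieExp_neg he0 he, ← neg_smul,
        lieAd_lieExp_of_bracket_bracket_eq_zero he0 he (hnil' _ _ _), ← lie_skew X Y]
      module
    have hB : ∀ W, lieAd (e (-(t ^ 2 / 2) • ⁅X, Y⁆))⁻¹ W = W := fun W => by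
      rw [← lieExp_neg he0 he, lieAd_lieExp_of_bracket_eq_zero he0 he]
      rw [neg_lie, smul_lie, hnil, smul_zero, neg_zero]
    rw [hA, hB]
    module
  have h1 := hc X Y 1
  -- The same identity for the commuting pair `X + Y`, `½[X, Y]` moves the correction factor into
  -- the exponent.
  have h2 := hc (X + Y) ((1 / 2 : ℝ) • ⁅X, Y⁆) 1
  rw [lie_smul, hnil', smul_zero, smul_zero, he0, mul_one] at h2
  simp only [one_smul] at h1 h2
  rw [← h2, ← h1, mul_assoc, ← lieExp_add_smul he0 he]
  simp [he0]

end TwoStep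

/-! ### Coordinates of the second kind on a Lie group -/

section SecondKind

variable {E : Type*} [NormedAddCommGroup E] [NormedSpace ℝ E]
  {G : Type*} [TopologicalSpace G] [ChartedSpace E G] [Group G]
  [LieGroup 𝓘(ℝ, E) ∞ G]
  {e : GroupLieAlgebra 𝓘(ℝ, E) G → G}

theorem eventually_continuousAt_leftField {m : E × E → E} {c : E} (hm : ContDiffAt ℝ 2 m (c, c))
    (v : E) : ∀ᶠ x in 𝓝 c, ContinuousAt (leftField m c v) x := by
  have h1 : ContDiffAt ℝ 1 (fderiv ℝ m) (c, c) := hm.fderiv_right (by norm_num)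
  have h2 : ContDiffAt ℝ 1 (fun x : E => (x, c)) c := by fun_prop
  have h3 : ContDiffAt ℝ 1 (fun x : E => fderiv ℝ m (x, c)) c :=
    ContDiffAt.comp (f := fun x : E => (x, c)) c h1 h2
  have h4 : ContDiffAt ℝ 1 (leftField m c v) c := h3.clm_apply contDiffAt_const
  exact (h4.eventually (by simp)).mono fun x hx => hx.continuousAt

/-- The derivative is the value of a continuous field along the curve, hence continuous. Regularity
of each single curve suffices for coordinates of the second kind; joint smoothness of `e` is not
needed. -/
theorem contDiffAt_extChartAt_lieExp (he0 : e 0 = 1)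
    (he : ∀ X t, HasLeftDerivAt (fun t : ℝ => e (t • X)) X t) (X : GroupLieAlgebra 𝓘(ℝ, E) G) :
    ContDiffAt ℝ 1 (fun t : ℝ => extChartAt 𝓘(ℝ, E) (1 : G) (e (t • X))) 0 := by
  have hc : Tendsto (fun t : ℝ => e (t • X)) (𝓝 0) (𝓝 1) := by
    have := (he X 0).1.tendsto
    simpa [he0] using this
  have hc' : Tendsto (fun t : ℝ => extChartAt 𝓘(ℝ, E) (1 : G) (e (t • X))) (𝓝 0)
      (𝓝 (chartOne E G)) :=
    (continuousAt_extChartAt (I := 𝓘(ℝ, E)) (1 : G)).tendsto.comp hc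
  have h1 := eventually_hasDerivAt_extChartAt_lieExp he0 he X
  have h2 := hc'.eventually (eventually_continuousAt_leftField
    ((contDiffAt_chartMul (E := E) (G := G)).of_le (ENat.LEInfty.out (m := 2))) X)
  obtain ⟨u, hu, hu'⟩ := (h1.and h2).exists_mem
  rw [contDiffAt_one_iff]
  refine ⟨fun t => ContinuousLinearMap.toSpanSingleton ℝ
    (leftField (chartMul E G) (chartOne E G) X (extChartAt 𝓘(ℝ, E) (1 : G) (e (t • X)))),
    u, hu, fun t ht => ?_, fun t ht => (hu' t ht).1.hasFDerivAt⟩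
  have h3 : ContinuousAt (fun t : ℝ => leftField (chartMul E G) (chartOne E G) X
      (extChartAt 𝓘(ℝ, E) (1 : G) (e (t • X)))) t :=
    ContinuousAt.comp (f := fun t : ℝ => extChartAt 𝓘(ℝ, E) (1 : G) (e (t • X)))
      (hu' t ht).2 (hu' t ht).1.continuousAt
  exact ((ContinuousLinearMap.toSpanSingletonCLE (𝕜 := ℝ) (E := E)).continuous.continuousAt.comp
    h3).continuousWithinAt

theorem contMDiffAt_lieExp (he0 : e 0 = 1)
    (he : ∀ X t, HasLeftDerivAt (fun t : ℝ => e (t • X)) X t) (X : GroupLieAlgebra 𝓘(ℝ, E) G) :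
    ContMDiffAt 𝓘(ℝ, ℝ) 𝓘(ℝ, E) 1 (fun t : ℝ => e (t • X)) 0 := by
  have h1 := (contDiffAt_extChartAt_lieExp he0 he X).contMDiffAt
  have h0 : extChartAt 𝓘(ℝ, E) (1 : G) (e ((0 : ℝ) • X)) = chartOne E G := by
    rw [zero_smul, he0]; rfl
  have h2 : ContMDiffAt 𝓘(ℝ, E) 𝓘(ℝ, E) 1 (extChartAt 𝓘(ℝ, E) (1 : G)).symm
      (extChartAt 𝓘(ℝ, E) (1 : G) (e ((0 : ℝ) • X))) := by
    rw [h0]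
    exact contMDiffAt_extChartAt_symm_chartOne.of_le ENat.LEInfty.out
  have h3 := ContMDiffAt.comp (0 : ℝ) (f := fun t : ℝ => extChartAt 𝓘(ℝ, E) (1 : G) (e (t • X)))
    h2 h1
  refine h3.congr_of_eventuallyEq ?_
  have hc : Tendsto (fun t : ℝ => e (t • X)) (𝓝 0) (𝓝 1) := by
    have := (he X 0).1.tendsto
    simpa [he0] using this
  filter_upwards [hc.eventually (extChartAt_source_mem_nhds (I := 𝓘(ℝ, E)) (1 : G))] with t ht
  exact ((extChartAt 𝓘(ℝ, E) (1 : G)).left_inv ht).symm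

variable {n : ℕ}

/-- Canonical coordinates of the second kind. -/
noncomputable def expProd {n : ℕ} {𝔤 H : Type*} [AddCommGroup 𝔤] [Module ℝ 𝔤] [Group H]
    (e : 𝔤 → H) (X : Fin n → 𝔤) (l : List (Fin n)) (t : Fin n → ℝ) : H :=
  (l.map fun i => e (t i • X i)).prod

theorem expProd_zero {𝔤 H : Type*} [AddCommGroup 𝔤] [Module ℝ 𝔤] [Group H]
    {e : 𝔤 → H} (he0 : e 0 = 1) (X : Fin n → 𝔤) (l : List (Fin n)) : expProd e X l 0 = 1 := by
  induction l with
  | nil => rfl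
  | cons i l ih => simp [expProd, he0]

/-- On a coordinate axis every other factor is `e 0 = 1`, and `Nodup` ensures that the remaining
factor occurs only once. -/
theorem expProd_single {𝔤 H : Type*} [AddCommGroup 𝔤] [Module ℝ 𝔤] [Group H]
    {e : 𝔤 → H} (he0 : e 0 = 1) (X : Fin n → 𝔤) {l : List (Fin n)} (hl : l.Nodup) {i : Fin n}
    (hi : i ∈ l) (s : ℝ) : expProd e X l (s • Pi.single i 1) = e (s • X i) := by
  have h0 : ∀ l : List (Fin n), i ∉ l → expProd e X l (s • Pi.single i 1) = 1 := by
    intro l hl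
    induction l with
    | nil => rfl
    | cons j l ih =>
      simp only [List.mem_cons, not_or] at hl
      have := ih hl.2
      simp only [expProd, List.map_cons, List.prod_cons] at this ⊢
      rw [this]
      simp [Pi.single_eq_of_ne (Ne.symm hl.1), he0]
  induction l with
  | nil => simp at hi
  | cons j l ih =>
    rw [List.nodup_cons] at hl
    rw [expProd, List.map_cons, List.prod_cons]
    change _ * expProd e X l _ = _
    by_cases hij : j = i
    · subst hij
      rw [h0 l hl.1]
      simp
    · rw [ih hl.2 ((List.mem_cons.mp hi).resolve_left (Ne.symm hij))]
      simp [Pi.single_eq_of_ne hij, he0]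

theorem contMDiffAt_expProd (he0 : e 0 = 1)
    (he : ∀ X t, HasLeftDerivAt (fun t : ℝ => e (t • X)) X t)
    (X : Fin n → GroupLieAlgebra 𝓘(ℝ, E) G) (l : List (Fin n)) :
    ContMDiffAt 𝓘(ℝ, Fin n → ℝ) 𝓘(ℝ, E) 1 (expProd e X l) 0 := by
  induction l with
  | nil => exact contMDiffAt_const
  | cons i l ih =>
    have h1 : ContMDiffAt 𝓘(ℝ, Fin n → ℝ) 𝓘(ℝ, ℝ) 1 (fun t : Fin n → ℝ => t i) 0 :=
      (contDiff_apply ℝ ℝ i).contDiffAt.contMDiffAt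
    have h2 : ContMDiffAt 𝓘(ℝ, Fin n → ℝ) 𝓘(ℝ, E) 1 (fun t : Fin n → ℝ => e (t i • X i)) 0 :=
      ContMDiffAt.comp (0 : Fin n → ℝ) (f := fun t : Fin n → ℝ => t i)
        (contMDiffAt_lieExp he0 he (X i)) h1
    exact h2.mul ih

theorem hasStrictFDerivAt_of_hasDerivAt_single [CompleteSpace E] (b : Module.Basis (Fin n) ℝ E)
    {f : (Fin n → ℝ) → E} (hf : ContDiffAt ℝ 1 f 0)
    (h : ∀ i, HasDerivAt (fun s : ℝ => f (s • (Pi.single i 1 : Fin n → ℝ))) (b i) 0) :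
    HasStrictFDerivAt f (b.equivFunL.symm : (Fin n → ℝ) →L[ℝ] E) 0 := by
  have h3 := hf.hasStrictFDerivAt (by norm_num)
  suffices h' : fderiv ℝ f 0 = (b.equivFunL.symm : (Fin n → ℝ) →L[ℝ] E) by rwa [h'] at h3
  apply ContinuousLinearMap.coe_injective
  refine (Pi.basisFun ℝ (Fin n)).ext fun i => ?_
  have h4 : HasDerivAt (fun s : ℝ => s • (Pi.single i 1 : Fin n → ℝ)) (Pi.single i 1) 0 := by
    simpa using (hasDerivAt_id (0 : ℝ)).smul_const (Pi.single i 1 : Fin n → ℝ)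
  have h5 := HasFDerivAt.comp_hasDerivAt_of_eq (0 : ℝ) h3.hasFDerivAt h4 (by simp)
  have h8 := h5.unique (h i)
  rw [Pi.basisFun_apply]
  refine h8.trans ?_
  exact (show b.equivFun.symm (Pi.single i 1) = b i by
    simp [Module.Basis.equivFun_symm_apply, Pi.single_apply]).symm

theorem hasStrictFDerivAt_expProd [CompleteSpace E] (he0 : e 0 = 1)
    (he : ∀ X t, HasLeftDerivAt (fun t : ℝ => e (t • X)) X t)
    (b : Module.Basis (Fin n) ℝ E) {X : Fin n → GroupLieAlgebra 𝓘(ℝ, E) G} (hX : ∀ i, X i = b i)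
    {l : List (Fin n)} (hl : l.Nodup) (hl' : ∀ i, i ∈ l) :
    HasStrictFDerivAt (fun t => extChartAt 𝓘(ℝ, E) (1 : G) (expProd e X l t))
      (b.equivFunL.symm : (Fin n → ℝ) →L[ℝ] E) 0 := by
  have h1 : ContMDiffAt 𝓘(ℝ, E) 𝓘(ℝ, E) 1 (extChartAt 𝓘(ℝ, E) (1 : G))
      (expProd e X l 0) := by
    rw [expProd_zero he0]
    exact contMDiffAt_extChartAt
  have h2 : ContDiffAt ℝ 1 (fun t => extChartAt 𝓘(ℝ, E) (1 : G) (expProd e X l t)) 0 :=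
    contMDiffAt_iff_contDiffAt.mp (h1.comp 0 (contMDiffAt_expProd he0 he X l))
  refine hasStrictFDerivAt_of_hasDerivAt_single b h2 fun i => ?_
  have h6 := hasDerivAt_extChartAt_lieExp he0 he (X i)
  have h7 : (fun s : ℝ => extChartAt 𝓘(ℝ, E) (1 : G)
      (expProd e X l (s • (Pi.single i 1 : Fin n → ℝ)))) =
      fun t : ℝ => extChartAt 𝓘(ℝ, E) (1 : G) (e (t • X i)) := by
    ext s
    exact congrArg _ (expProd_single he0 X hl (hl' i) s)
  rw [h7]
  exact h6.congr_deriv (hX i)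

/-- The derivative at `0` is the isomorphism given by the basis `b`, so the inverse function theorem
applies in the chart; the inverse chart carries the conclusion back to `G`. -/
theorem map_expProd_nhds_zero [CompleteSpace E] (he0 : e 0 = 1)
    (he : ∀ X t, HasLeftDerivAt (fun t : ℝ => e (t • X)) X t)
    (b : Module.Basis (Fin n) ℝ E) {X : Fin n → GroupLieAlgebra 𝓘(ℝ, E) G} (hX : ∀ i, X i = b i)
    {l : List (Fin n)} (hl : l.Nodup) (hl' : ∀ i, i ∈ l) :
    map (expProd e X l) (𝓝 0) = 𝓝 (1 : G) := by
  have h := (hasStrictFDerivAt_expProd he0 he b hX hl hl').map_nhds_eq_of_equiv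
  rw [expProd_zero he0] at h
  have h1 : Tendsto (expProd e X l) (𝓝 0) (𝓝 (1 : G)) := by
    have := (contMDiffAt_expProd he0 he X l).continuousAt.tendsto
    rwa [expProd_zero he0] at this
  have h2 := congrArg (map (extChartAt 𝓘(ℝ, E) (1 : G)).symm) h
  rw [map_map] at h2
  have h3 : map ((extChartAt 𝓘(ℝ, E) (1 : G)).symm ∘
      fun t => extChartAt 𝓘(ℝ, E) (1 : G) (expProd e X l t)) (𝓝 0) =
      map (expProd e X l) (𝓝 0) := by
    refine map_congr ?_
    filter_upwards [h1.eventually (extChartAt_source_mem_nhds (I := 𝓘(ℝ, E)) (1 : G))] with t ht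
    exact (extChartAt 𝓘(ℝ, E) (1 : G)).left_inv ht
  rw [← h3, h2]
  have h4 := map_extChartAt_symm_nhdsWithin_range (I := 𝓘(ℝ, E)) (1 : G)
  simpa using h4

theorem exists_injOn_expProd [CompleteSpace E] (he0 : e 0 = 1)
    (he : ∀ X t, HasLeftDerivAt (fun t : ℝ => e (t • X)) X t)
    (b : Module.Basis (Fin n) ℝ E) {X : Fin n → GroupLieAlgebra 𝓘(ℝ, E) G} (hX : ∀ i, X i = b i)
    {l : List (Fin n)} (hl : l.Nodup) (hl' : ∀ i, i ∈ l) :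
    ∃ W ∈ 𝓝 (0 : Fin n → ℝ), Set.InjOn (expProd e X l) W := by
  have h := hasStrictFDerivAt_expProd he0 he b hX hl hl'
  refine ⟨_, (h.toOpenPartialHomeomorph _).open_source.mem_nhds
      h.mem_toOpenPartialHomeomorph_source, fun s hs t ht hst => ?_⟩
  exact (h.toOpenPartialHomeomorph _).injOn hs ht
    (congrArg (extChartAt 𝓘(ℝ, E) (1 : G)) hst)

end SecondKind

/-! ### Topology and second-kind coordinates of the H-type group -/

section HTypeTopology

variable {U V : Type*}
  [NormedAddCommGroup U] [InnerProductSpace ℝ U] [FiniteDimensional ℝ U]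
  [NormedAddCommGroup V] [InnerProductSpace ℝ V] [FiniteDimensional ℝ V]

namespace OrthogonalMultiplication

variable (M : OrthogonalMultiplication U V)

/-- The pairing as a continuous bilinear map. -/
noncomputable def pairingL : V →L[ℝ] V →L[ℝ] U :=
  LinearMap.toContinuousLinearMap
    ((LinearMap.toContinuousLinearMap : (V →ₗ[ℝ] U) ≃ₗ[ℝ] (V →L[ℝ] U)).toLinearMap ∘ₗ
      LinearMap.mk₂ ℝ M.pairing M.pairing_add_left (fun c v w => by simp [pairing])
        M.pairing_add_right M.pairing_smul_right)

theorem pairingL_apply (v w : V) : M.pairingL v w = M.pairing v w := rfl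

theorem continuous_pairing {X : Type*} [TopologicalSpace X] {f g : X → V} (hf : Continuous f)
    (hg : Continuous g) : Continuous fun x => M.pairing (f x) (g x) := by
  simp only [← pairingL_apply]
  fun_prop

end OrthogonalMultiplication

namespace HTypeGroup

variable {M : OrthogonalMultiplication U V}

/-- The coordinates of the H-type group. -/
def toProd : HTypeGroup M ≃ₜ U × V := Homeomorph.refl _

theorem toProd_mul (x y : HTypeGroup M) : toProd (x * y) =
    ((toProd x).1 + (toProd y).1 + (1 / 2 : ℝ) • M.pairing (toProd x).2 (toProd y).2,
      (toProd x).2 + (toProd y).2) := by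
  refine Prod.ext rfl ?_
  change (toProd x).2 + (toProd y).2 + (1 / 2 : ℝ) • (0 : V) = _
  simp

theorem toProd_inv (x : HTypeGroup M) : toProd x⁻¹ = -toProd x := rfl

theorem toProd_one : toProd (1 : HTypeGroup M) = 0 := rfl

instance : IsTopologicalGroup (HTypeGroup M) where
  continuous_mul := by
    rw [← toProd.comp_continuous_iff]
    have h1 : Continuous fun p : HTypeGroup M × HTypeGroup M => toProd p.1 :=
      toProd.continuous.comp continuous_fst
    have h2 : Continuous fun p : HTypeGroup M × HTypeGroup M => toProd p.2 :=
      toProd.continuous.comp continuous_snd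
    have h3 := M.continuous_pairing h1.snd h2.snd
    have h4 : (toProd ∘ fun p : HTypeGroup M × HTypeGroup M => p.1 * p.2) = fun p =>
        ((toProd p.1).1 + (toProd p.2).1 + (1 / 2 : ℝ) • M.pairing (toProd p.1).2 (toProd p.2).2,
      (toProd p.1).2 + (toProd p.2).2) := funext fun p => toProd_mul p.1 p.2
    rw [h4]
    exact ((h1.fst.add h2.fst).add (h3.const_smul _)).prodMk (h1.snd.add h2.snd)
  continuous_inv := by
    rw [← toProd.comp_continuous_iff]
    exact toProd.continuous.neg

instance : PathConnectedSpace (HTypeGroup M) := inferInstanceAs (PathConnectedSpace (U × V))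

variable {n : ℕ}

theorem contDiff_toProd_expProd (Y : Fin n → HTypeAlgebra M) (l : List (Fin n)) :
    ContDiff ℝ 1 fun t => toProd (expProd (exp (M := M)) Y l t) := by
  induction l with
  | nil => exact contDiff_const
  | cons i l ih =>
    have h : (fun t => toProd (expProd (exp (M := M)) Y (i :: l) t)) = fun t : Fin n → ℝ =>
        (t i • (Y i).1 + (toProd (expProd (exp (M := M)) Y l t)).1 +
          (1 / 2 : ℝ) • M.pairingL (t i • (Y i).2) (toProd (expProd (exp (M := M)) Y l t)).2,
          t i • (Y i).2 + (toProd (expProd (exp (M := M)) Y l t)).2) := by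
      funext t
      exact toProd_mul (exp (t i • Y i)) (expProd (exp (M := M)) Y l t)
    rw [h]
    have hi : ContDiff ℝ 1 (fun t : Fin n → ℝ => t i) := contDiff_apply ℝ ℝ i
    have h2 : ContDiff ℝ 1 fun t : Fin n → ℝ => M.pairingL (t i • (Y i).2) :=
      M.pairingL.contDiff.comp (hi.smul contDiff_const)
    exact (((hi.smul contDiff_const).add ih.fst).add ((h2.clm_apply ih.snd).const_smul _)).prodMk
      ((hi.smul contDiff_const).add ih.snd)

/-- The counterpart on `N` of the statement for `G`. Here the exponential is the identity in
coordinates, so the derivative along each axis is read off directly. -/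
theorem map_expProd_nhds_zero (b : Module.Basis (Fin n) ℝ (U × V)) {Y : Fin n → HTypeAlgebra M}
    (hY : ∀ i, ((Y i).1, (Y i).2) = b i) {l : List (Fin n)} (hl : l.Nodup) (hl' : ∀ i, i ∈ l) :
    map (expProd (exp (M := M)) Y l) (𝓝 0) = 𝓝 1 := by
  have h : HasStrictFDerivAt (fun t => toProd (expProd (exp (M := M)) Y l t))
      (b.equivFunL.symm : (Fin n → ℝ) →L[ℝ] U × V) 0 := by
    refine hasStrictFDerivAt_of_hasDerivAt_single b
      (contDiff_toProd_expProd Y l).contDiffAt fun i => ?_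
    have h1 : (fun s : ℝ => toProd (expProd (exp (M := M)) Y l (s • (Pi.single i 1 : Fin n → ℝ)))) =
        fun s : ℝ => s • b i := by
      funext s
      rw [expProd_single exp_zero Y hl (hl' i), ← hY]
      rfl
    rw [h1]
    simpa using (hasDerivAt_id (0 : ℝ)).smul_const (b i)
  have h1 := h.map_nhds_eq_of_equiv
  rw [expProd_zero exp_zero] at h1
  have h2 := congrArg (map (toProd (M := M)).symm) h1
  rw [map_map, (toProd (M := M)).symm.map_nhds_eq, Homeomorph.symm_apply_apply] at h2
  exact h2

end HTypeGroup

end HTypeTopology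

/-! ### Local isomorphisms of topological groups and transport of lattices -/

section LocalIsomorphism

variable {H G : Type*} [Group H] [TopologicalSpace H] [IsTopologicalGroup H]
  [Group G] [TopologicalSpace G] [IsTopologicalGroup G]

omit [IsTopologicalGroup H] in
-- The range contains a neighbourhood of `1`, so it is an open, hence closed, subgroup of a
-- connected group.
theorem MonoidHom.surjective_of_map_nhds_one [ConnectedSpace G] (F : H →* G)
    (hF : map F (𝓝 1) = 𝓝 1) : Function.Surjective F := by
  have h1 : IsOpen (F.range : Set G) := by
    refine Subgroup.isOpen_of_mem_nhds _ (g := 1) ?_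
    rw [← hF, mem_map]
    exact Filter.univ_mem' fun x => ⟨x, rfl⟩
  have h2 : (F.range : Set G) = Set.univ :=
    IsClopen.eq_univ ⟨Subgroup.isClosed_of_isOpen _ h1, h1⟩ ⟨1, one_mem _⟩
  intro g
  have : g ∈ (F.range : Set G) := h2 ▸ Set.mem_univ g
  exact this

/-- A homomorphism of topological groups that is a local homeomorphism at the identity, from a
path-connected group to a simply connected group, is an isomorphism. -/
theorem MonoidHom.exists_continuousMulEquiv_of_map_nhds_one [PathConnectedSpace H]
    [SimplyConnectedSpace G] (F : H →* G) (hF : map F (𝓝 1) = 𝓝 1)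
    (hinj : ∃ W ∈ 𝓝 (1 : H), Set.InjOn F W) : ∃ F' : H ≃ₜ* G, ∀ x, F' x = F x := by
  have hc : Continuous F := by
    refine continuous_of_continuousAt_one F ?_
    rw [ContinuousAt, map_one]
    exact hF.le
  have ho : IsOpenMap F := IsTopologicalGroup.isOpenMap_iff_nhds_one.mpr hF.ge
  have hs := F.surjective_of_map_nhds_one hF
  have hd : IsDiscrete (F.ker : Set H) := by
    refine ⟨discreteTopology_of_isOpen_singleton_one (G := F.ker) ?_⟩
    obtain ⟨W, hW, hWF⟩ := hinj
    have h1 : ((↑) : F.ker → H) ⁻¹' W = {1} := by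
      ext x
      simp only [Set.mem_preimage, Set.mem_singleton_iff]
      refine ⟨fun hx => Subtype.ext (hWF hx (mem_of_mem_nhds hW) ?_), fun hx => ?_⟩
      · rw [x.2, OneMemClass.coe_one, map_one]
      · rw [hx]; exact mem_of_mem_nhds hW
    have h2 : ({1} : Set F.ker) ∈ 𝓝 (1 : F.ker) := by
      rw [← h1]
      exact continuous_subtype_val.continuousAt.preimage_mem_nhds hW
    exact isOpen_iff_mem_nhds.mpr fun x hx => by rw [Set.mem_singleton_iff.mp hx]; exact h2
  -- `F` is now a covering whose deck group is its kernel. As `H` is path-connected, the fundamental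
  -- group of `G` maps onto the opposite of the kernel; as it is trivial, so is the kernel.
  have hq := (ho.isQuotientMap hc hs).isQuotientCoveringMap_of_isDiscrete_ker_monoidHom hd
  have hi : Function.Injective F := by
    rw [← MonoidHom.ker_eq_bot_iff, Subgroup.eq_bot_iff_forall]
    intro x hx
    obtain ⟨γ, hγ⟩ := hq.fundamentalGroupToMulOpposite_surjective ⟨1, (rfl : F 1 = F 1)⟩
      (MulOpposite.op ⟨x, hx⟩)
    rw [Subsingleton.elim γ 1, map_one] at hγ
    exact (congrArg (fun y => (y.unop : H)) hγ).symm
  refine ⟨{ MulEquiv.ofBijective F ⟨hi, hs⟩ with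
    continuous_toFun := hc
    continuous_invFun := ?_ }, fun x => rfl⟩
  exact (Equiv.ofBijective F ⟨hi, hs⟩).toHomeomorphOfContinuousOpen hc ho |>.symm.continuous

omit [IsTopologicalGroup H] [IsTopologicalGroup G] in
theorem IsCocompactLattice.map_equiv {Γ : Subgroup H} (hΓ : IsCocompactLattice Γ) (F : H ≃ₜ* G) :
    IsCocompactLattice (Γ.map (F : H →* G)) := by
  obtain ⟨h1, h2⟩ := hΓ
  constructor
  · have h3 : IsDiscrete (F '' (Γ : Set H)) :=
      (isDiscrete_iff_discreteTopology.mpr h1).image F.toHomeomorph.isInducing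
    exact h3.to_subtype
  · let f : H ⧸ Γ → G ⧸ Γ.map (F : H →* G) := Quotient.map' F fun x y hxy => by
      rw [QuotientGroup.leftRel_apply] at hxy ⊢
      exact ⟨x⁻¹ * y, hxy, by simp⟩
    have hf : Continuous f := F.continuous_toFun.quotient_map' _
    have hs : Function.Surjective f := by
      intro y
      obtain ⟨y, rfl⟩ := QuotientGroup.mk_surjective y
      refine ⟨QuotientGroup.mk (F.symm y), ?_⟩
      exact congrArg QuotientGroup.mk (F.apply_symm_apply y)
    refine ⟨?_⟩
    rw [← hs.range_eq]
    exact isCompact_range hf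

omit [IsTopologicalGroup H] in
theorem compactSpace_quotient_of_isCompact {Γ : Subgroup H} {K : Set H} (hK : IsCompact K)
    (h : ∀ x : H, ∃ y ∈ K, y⁻¹ * x ∈ Γ) : CompactSpace (H ⧸ Γ) := by
  refine ⟨?_⟩
  have h1 : (QuotientGroup.mk '' K : Set (H ⧸ Γ)) = Set.univ := by
    refine Set.eq_univ_of_forall fun x => ?_
    obtain ⟨x, rfl⟩ := QuotientGroup.mk_surjective x
    obtain ⟨y, hy, hxy⟩ := h x
    exact ⟨y, hy, QuotientGroup.eq.mpr hxy⟩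
  rw [← h1]
  exact hK.image QuotientGroup.continuous_mk

end LocalIsomorphism

/-! ### Simply connected Lie groups of H-type -/

section HTypeLieGroup

variable {U V : Type*}
  [NormedAddCommGroup U] [InnerProductSpace ℝ U] [FiniteDimensional ℝ U]
  [NormedAddCommGroup V] [InnerProductSpace ℝ V] [FiniteDimensional ℝ V]
  {M : OrthogonalMultiplication U V}
  {E : Type*} [NormedAddCommGroup E] [NormedSpace ℝ E] [FiniteDimensional ℝ E]
  {G : Type*} [TopologicalSpace G] [T2Space G] [ChartedSpace E G] [Group G]
  [LieGroup 𝓘(ℝ, E) ∞ G] [SimplyConnectedSpace G]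

/-- A simply connected Lie group with an H-type Lie algebra is isomorphic, by its exponential map,
to the H-type group. -/
theorem exists_continuousMulEquiv_lieExp [CompleteSpace E] {e : GroupLieAlgebra 𝓘(ℝ, E) G → G}
    (he0 : e 0 = 1)
    (he : ∀ X t, HasLeftDerivAt (fun t : ℝ => e (t • X)) X t)
    (φ : HTypeAlgebra M ≃ₗ⁅ℝ⁆ GroupLieAlgebra 𝓘(ℝ, E) G) :
    ∃ F : HTypeGroup M ≃ₜ* G, ∀ X : HTypeAlgebra M, F (HTypeGroup.exp X) = e (φ X) := by
  have : IsTopologicalGroup G := topologicalGroup_of_lieGroup 𝓘(ℝ, E) ∞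
  have hnil : ∀ X Y Z : GroupLieAlgebra 𝓘(ℝ, E) G, ⁅⁅X, Y⁆, Z⁆ = 0 := by
    intro X Y Z
    obtain ⟨X, rfl⟩ := φ.surjective X
    obtain ⟨Y, rfl⟩ := φ.surjective Y
    obtain ⟨Z, rfl⟩ := φ.surjective Z
    have h : ⁅⁅X, Y⁆, Z⁆ = 0 := HTypeAlgebra.ext (M.pairing_zero_left Z.2) rfl
    change ⁅⁅φ X, φ Y⁆, φ Z⁆ = 0
    rw [← LieEquiv.map_lie, ← LieEquiv.map_lie, h, map_zero]
  let F : HTypeGroup M →* G := MonoidHom.mk' (fun x => e (φ (HTypeGroup.log x))) (by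
    intro x y
    obtain ⟨x, rfl⟩ := HTypeGroup.exp.surjective x
    obtain ⟨y, rfl⟩ := HTypeGroup.exp.surjective y
    rw [lieExp_mul_lieExp he0 he hnil, ← LieEquiv.map_lie]
    change e (φ (x + y + (1 / 2 : ℝ) • ⁅x, y⁆)) = _
    rw [map_add, map_add, map_smul]
    rfl)
  let b : Module.Basis (Fin (Module.finrank ℝ E)) ℝ E := Module.finBasis ℝ E
  let ψ : E ≃ₗ[ℝ] U × V := (φ.toLinearEquiv.symm : GroupLieAlgebra 𝓘(ℝ, E) G ≃ₗ[ℝ] HTypeAlgebra M)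
  let X : Fin (Module.finrank ℝ E) → GroupLieAlgebra 𝓘(ℝ, E) G := fun i => b i
  let Y : Fin (Module.finrank ℝ E) → HTypeAlgebra M := fun i => φ.symm (X i)
  let l := List.finRange (Module.finrank ℝ E)
  have hl : l.Nodup := List.nodup_finRange _
  have hl' : ∀ i, i ∈ l := List.mem_finRange
  have hP := HTypeGroup.map_expProd_nhds_zero (b.map ψ) (Y := Y) (fun i => by
    rw [Module.Basis.map_apply]; rfl) hl hl'
  have hΨ := map_expProd_nhds_zero he0 he b (X := X) (fun _ => rfl) hl hl'
  -- `F` sends coordinates of the second kind on `N` to those on `G`. Both parametrizations map `𝓝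
  -- 0` onto `𝓝 1`, so `F` maps `𝓝 1` onto `𝓝 1`, and local injectivity passes from the coordinates
  -- on `G` to `F`.
  have hF : F ∘ expProd HTypeGroup.exp Y l = expProd e X l := by
    funext t
    simp only [Function.comp_apply, expProd, map_list_prod, List.map_map]
    congr 1
    refine List.map_congr_left fun i _ => ?_
    change e (φ (t i • φ.symm (X i))) = _
    rw [map_smul, LieEquiv.apply_symm_apply]
  obtain ⟨F', hF'⟩ := F.exists_continuousMulEquiv_of_map_nhds_one
    (by rw [← hP, map_map, hF, hΨ]) (by
      obtain ⟨W, hW, hWi⟩ := exists_injOn_expProd he0 he b (X := X) (fun _ => rfl) hl hl'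
      refine ⟨expProd HTypeGroup.exp Y l '' W, hP ▸ image_mem_map hW, ?_⟩
      rintro _ ⟨s, hs, rfl⟩ _ ⟨t, ht, rfl⟩ hst
      have h1 := congrFun hF s
      have h2 := congrFun hF t
      simp only [Function.comp_apply] at h1 h2
      rw [hWi hs ht (h1.symm.trans (hst.trans h2))])
  exact ⟨F', fun x => hF' _⟩

end HTypeLieGroup

/-! ### Orthonormal bases permuted up to sign -/

section SignedSystems

variable {V : Type*} [NormedAddCommGroup V] [InnerProductSpace ℝ V]

/-- A monoid of orthogonal endomorphisms with squares `±1`, any two of which commute or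
anticommute. -/
structure IsSignMonoid (S : Submonoid (Module.End ℝ V)) : Prop where
  inner_map : ∀ a ∈ S, ∀ v w, inner ℝ (a v) (a w) = inner ℝ v w
  sq : ∀ a ∈ S, (∀ v, a (a v) = v) ∨ ∀ v, a (a v) = -v
  comm : ∀ a ∈ S, ∀ b ∈ S, (∀ v, a (b v) = b (a v)) ∨ ∀ v, a (b v) = -b (a v)

theorem IsSignMonoid.closure {T : Set (Module.End ℝ V)}
    (h1 : ∀ a ∈ T, ∀ v w, inner ℝ (a v) (a w) = inner ℝ v w)
    (h2 : ∀ a ∈ T, (∀ v, a (a v) = v) ∨ ∀ v, a (a v) = -v)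
    (h3 : ∀ a ∈ T, ∀ b ∈ T, (∀ v, a (b v) = b (a v)) ∨ ∀ v, a (b v) = -b (a v)) :
    IsSignMonoid (Submonoid.closure T) := by
  have hcomm : ∀ a ∈ Submonoid.closure T, ∀ b ∈ Submonoid.closure T,
      (∀ v, a (b v) = b (a v)) ∨ ∀ v, a (b v) = -b (a v) := by
    intro a ha b hb
    induction ha, hb using Submonoid.closure_induction₂ with
    | mem a b ha hb => exact h3 a ha b hb
    | one_left b hb => left; simp
    | one_right a ha => left; simp
    | mul_left a b c ha hb hc hac hbc =>
      rcases hac with hac | hac <;> rcases hbc with hbc | hbc <;> simp [hac, hbc]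
    | mul_right a b c ha hb hc hab hac =>
      rcases hab with hab | hab <;> rcases hac with hac | hac <;> simp [hab, hac]
  refine ⟨fun a ha => ?_, fun a ha => ?_, hcomm⟩
  · induction ha using Submonoid.closure_induction with
    | mem a ha => exact h1 a ha
    | one => simp
    | mul a b ha hb iha ihb => simp [iha, ihb]
  · induction ha using Submonoid.closure_induction with
    | mem a ha => exact h2 a ha
    | one => simp
    | mul a b ha hb iha ihb =>
      rcases hcomm b hb a ha with h | h <;> rcases iha with iha | iha <;>
        rcases ihb with ihb | ihb <;> simp [h, iha, ihb]

/-- The common fixed space of the stabilizer of `v`. -/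
def stabilizerFixed (S : Submonoid (Module.End ℝ V)) (v : V) : Submodule ℝ V where
  carrier := {w | ∀ a ∈ S, a v = v → a w = w}
  add_mem' hx hy a ha hav := by rw [map_add, hx a ha hav, hy a ha hav]
  zero_mem' a _ _ := map_zero a
  smul_mem' c x hx a ha hav := by rw [map_smul, hx a ha hav]

/-- In an invariant subspace, there is a vector whose orbit consists of vectors that are pairwise
orthogonal or equal up to sign. -/
theorem IsSignMonoid.exists_signed_orbit [FiniteDimensional ℝ V] {S : Submonoid (Module.End ℝ V)}
    (hS : IsSignMonoid S) (K : Submodule ℝ V) (hK : ∀ a ∈ S, ∀ v ∈ K, a v ∈ K) (hK0 : K ≠ ⊥) :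
    ∃ v ∈ K, ‖v‖ = 1 ∧ ∀ g ∈ S, g v = v ∨ g v = -v ∨ inner ℝ (g v) v = 0 := by
  obtain ⟨x, hx, hx0⟩ := Submodule.exists_mem_ne_zero_of_ne_bot hK0
  -- A small fixed space stands for a large stabilizer. Measuring stabilizers by subspaces gives a
  -- minimal element by finite dimension alone, without finiteness of `S`.
  obtain ⟨_, ⟨v, ⟨hv, hv0⟩, rfl⟩, hmin⟩ := (wellFounded_lt (α := Submodule ℝ V)).has_min
    (stabilizerFixed S '' {v | v ∈ K ∧ v ≠ 0}) ⟨_, x, ⟨hx, hx0⟩, rfl⟩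
  have key : ∀ g ∈ S, g v = v ∨ g v = -v ∨ inner ℝ (g v) v = 0 := by
    intro g hg
    by_contra hcon
    simp only [not_or] at hcon
    obtain ⟨h1, h2, h3⟩ := hcon
    rcases hS.sq g hg with hsq | hsq
    -- An `a` fixing `v` and anticommuting with `g` would reverse the sign of `(g v, v)`, which is
    -- nonzero. So the stabilizer of `v` also fixes `g v`.
    · have hcomm : ∀ a ∈ S, a v = v → a (g v) = g v := by
        intro a ha hav
        rcases hS.comm a ha g hg with h | h
        · rw [h, hav]
        · refine absurd ?_ h3
          have h4 : inner ℝ (a (g v)) (a v) = inner ℝ (g v) v := hS.inner_map a ha _ _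
          rw [h, hav, inner_neg_left] at h4
          linarith
      have hw0 : v + g v ≠ 0 := fun h => h2 (eq_neg_of_add_eq_zero_right h)
      refine hmin _ ⟨v + g v, ⟨K.add_mem hv (hK g hg v hv), hw0⟩, rfl⟩ ?_
      refine lt_of_le_of_ne (fun y hy a ha hav => hy a ha ?_) (fun heq => h1 ?_)
      · rw [map_add, hav, hcomm a ha hav]
      -- The inclusion of fixed spaces is strict: `g` fixes `v + g v` because `g² = 1`, so equality
      -- would force `g v = v`.
      · have hv1 : v ∈ stabilizerFixed S v := fun a _ hav => hav
        rw [← heq] at hv1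
        exact hv1 g hg (by rw [map_add, hsq, add_comm])
    · have h4 : inner ℝ (g (g v)) (g v) = inner ℝ (g v) v := hS.inner_map g hg _ _
      rw [hsq, inner_neg_left, real_inner_comm] at h4
      exact h3 (by linarith)
  refine ⟨‖v‖⁻¹ • v, K.smul_mem _ hv, norm_smul_inv_norm hv0, fun g hg => ?_⟩
  rcases key g hg with h | h | h
  · left; rw [map_smul, h]
  · right; left; rw [map_smul, h, smul_neg]
  · right; right; rw [map_smul, inner_smul_left, inner_smul_right, h]; simp

/-- A set of unit vectors, invariant under a monoid and under negation, that are pairwise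
orthogonal or equal up to sign. -/
structure IsSignedSystem (S : Submonoid (Module.End ℝ V)) (T : Set V) : Prop where
  norm_eq : ∀ v ∈ T, ‖v‖ = 1
  pair : ∀ v ∈ T, ∀ w ∈ T, v = w ∨ v = -w ∨ inner ℝ v w = 0
  neg_mem : ∀ v ∈ T, -v ∈ T
  map_mem : ∀ a ∈ S, ∀ v ∈ T, a v ∈ T

/-- An orthogonal map with square `±1` is its own inverse up to sign, hence symmetric or skew. This
makes orthogonal complements of invariant sets invariant. -/
theorem IsSignMonoid.inner_map_right {S : Submonoid (Module.End ℝ V)} (hS : IsSignMonoid S)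
    {a : Module.End ℝ V} (ha : a ∈ S) (v w : V) :
    inner ℝ v (a w) = inner ℝ (a v) w ∨ inner ℝ v (a w) = -inner ℝ (a v) w := by
  have h := hS.inner_map a ha v (a w)
  rcases hS.sq a ha with h1 | h1
  · left; rw [← h, h1]
  · right; rw [← h, h1, inner_neg_right]

/-- As `k` is symmetric or skew with square `±1`, the pair `g v`, `k v` reduces to `k g v`, `v`,
which the hypothesis covers. -/
theorem IsSignMonoid.isSignedSystem_orbit {S : Submonoid (Module.End ℝ V)} (hS : IsSignMonoid S)
    {v : V} (hv : ‖v‖ = 1) (h : ∀ g ∈ S, g v = v ∨ g v = -v ∨ inner ℝ (g v) v = 0) :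
    IsSignedSystem S {w | ∃ g ∈ S, w = g v ∨ w = -g v} := by
  have key : ∀ g ∈ S, ∀ k ∈ S, g v = k v ∨ g v = -k v ∨ inner ℝ (g v) (k v) = 0 := by
    intro g hg k hk
    have h0 := hS.inner_map_right hk (g v) v
    have h1 := h (k * g) (mul_mem hk hg)
    simp only [Module.End.mul_apply] at h1
    rcases h1 with h1 | h1 | h1
    · have h2 := congrArg k h1
      rcases hS.sq k hk with h3 | h3 <;> rw [h3] at h2
      · exact Or.inl h2
      · exact Or.inr (Or.inl (neg_eq_iff_eq_neg.mp h2))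
    · have h2 := congrArg k h1
      rw [map_neg] at h2
      rcases hS.sq k hk with h3 | h3 <;> rw [h3] at h2
      · exact Or.inr (Or.inl h2)
      · exact Or.inl (neg_injective h2)
    · rw [h1, neg_zero, or_self] at h0
      exact Or.inr (Or.inr h0)
  refine ⟨?_, ?_, ?_, ?_⟩
  · rintro w ⟨g, hg, rfl | rfl⟩
    · rw [norm_eq_sqrt_real_inner, hS.inner_map g hg, ← norm_eq_sqrt_real_inner, hv]
    · rw [norm_neg, norm_eq_sqrt_real_inner, hS.inner_map g hg, ← norm_eq_sqrt_real_inner, hv]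
  · rintro _ ⟨g, hg, rfl | rfl⟩ _ ⟨k, hk, rfl | rfl⟩ <;>
      rcases key g hg k hk with h1 | h1 | h1 <;> simp [h1]
  · rintro _ ⟨g, hg, rfl | rfl⟩
    · exact ⟨g, hg, Or.inr rfl⟩
    · exact ⟨g, hg, Or.inl (neg_neg _)⟩
  · rintro a ha _ ⟨g, hg, rfl | rfl⟩
    · exact ⟨a * g, mul_mem ha hg, Or.inl rfl⟩
    · exact ⟨a * g, mul_mem ha hg, Or.inr (by rw [map_neg]; rfl)⟩

/-- A maximal signed system must span: otherwise the orbit of a suitable vector in the orthogonal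
complement could be adjoined. -/
theorem IsSignMonoid.exists_isSignedSystem_span_eq_top [FiniteDimensional ℝ V]
    {S : Submonoid (Module.End ℝ V)} (hS : IsSignMonoid S) :
    ∃ T : Set V, IsSignedSystem S T ∧ Submodule.span ℝ T = ⊤ := by
  obtain ⟨T, hT⟩ := zorn_subset {T | IsSignedSystem S T} (by
    intro c hc hchain
    refine ⟨⋃₀ c, ⟨?_, ?_, ?_, ?_⟩, fun s hs => Set.subset_sUnion_of_mem hs⟩
    · rintro v ⟨s, hs, hv⟩
      exact (hc hs).norm_eq v hv
    · rintro v ⟨s, hs, hv⟩ w ⟨t, ht, hw⟩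
      rcases hchain.total hs ht with h | h
      · exact (hc ht).pair v (h hv) w hw
      · exact (hc hs).pair v hv w (h hw)
    · rintro v ⟨s, hs, hv⟩
      exact ⟨s, hs, (hc hs).neg_mem v hv⟩
    · rintro a ha v ⟨s, hs, hv⟩
      exact ⟨s, hs, (hc hs).map_mem a ha v hv⟩)
  have hTs : IsSignedSystem S T := hT.prop
  refine ⟨T, hTs, ?_⟩
  by_contra hne
  have hK0 : (Submodule.span ℝ T)ᗮ ≠ ⊥ := fun h => hne (Submodule.orthogonal_eq_bot_iff.mp h)
  have hmem : ∀ w, w ∈ (Submodule.span ℝ T)ᗮ ↔ ∀ t ∈ T, inner ℝ t w = 0 := by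
    intro w
    rw [Submodule.mem_orthogonal]
    refine ⟨fun h t ht => h t (Submodule.subset_span ht), fun h t ht => ?_⟩
    induction ht using Submodule.span_induction with
    | mem x hx => exact h x hx
    | zero => exact inner_zero_left _
    | add x y _ _ hx hy => rw [inner_add_left, hx, hy, add_zero]
    | smul c x _ hx => rw [inner_smul_left, hx, mul_zero]
  obtain ⟨v, hv, hv1, horb⟩ := hS.exists_signed_orbit (Submodule.span ℝ T)ᗮ (by
    intro a ha v hv
    rw [hmem] at hv ⊢
    intro t ht
    rcases hS.inner_map_right ha t v with h | h <;> rw [h, hv _ (hTs.map_mem a ha t ht)]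
    exact neg_zero) hK0
  have hO := hS.isSignedSystem_orbit hv1 horb
  set O : Set V := {w | ∃ g ∈ S, w = g v ∨ w = -g v} with hOdef
  have hTO : ∀ t ∈ T, ∀ w ∈ O, inner ℝ t w = 0 := by
    rintro t ht _ ⟨g, hg, rfl | rfl⟩
    · rcases hS.inner_map_right hg t v with h | h <;>
        rw [h, (hmem v).mp hv _ (hTs.map_mem g hg t ht)]
      exact neg_zero
    · rw [inner_neg_right]
      rcases hS.inner_map_right hg t v with h | h <;>
        rw [h, (hmem v).mp hv _ (hTs.map_mem g hg t ht)] <;> simp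
  have hU : IsSignedSystem S (T ∪ O) := by
    refine ⟨?_, ?_, ?_, ?_⟩
    · rintro w (hw | hw)
      exacts [hTs.norm_eq w hw, hO.norm_eq w hw]
    · rintro w (hw | hw) x (hx | hx)
      · exact hTs.pair w hw x hx
      · exact Or.inr (Or.inr (hTO w hw x hx))
      · exact Or.inr (Or.inr (by rw [real_inner_comm]; exact hTO x hx w hw))
      · exact hO.pair w hw x hx
    · rintro w (hw | hw)
      exacts [Or.inl (hTs.neg_mem w hw), Or.inr (hO.neg_mem w hw)]
    · rintro a ha w (hw | hw)
      exacts [Or.inl (hTs.map_mem a ha w hw), Or.inr (hO.map_mem a ha w hw)]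
  have hvO : v ∈ O := ⟨1, one_mem _, Or.inl rfl⟩
  have hvT : v ∈ T := hT.le_of_ge hU Set.subset_union_left (Or.inr hvO)
  have h0 := hTO v hvT v hvO
  rw [real_inner_self_eq_norm_sq, hv1] at h0
  norm_num at h0

/-- A sign monoid on a Euclidean space acts by signed permutations of an orthonormal basis. -/
theorem IsSignMonoid.exists_orthonormalBasis [FiniteDimensional ℝ V]
    {S : Submonoid (Module.End ℝ V)} (hS : IsSignMonoid S) :
    ∃ b : OrthonormalBasis (Fin (Module.finrank ℝ V)) ℝ V, ∀ a ∈ S, ∀ i j,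
      inner ℝ (a (b i)) (b j) = 0 ∨ inner ℝ (a (b i)) (b j) = 1 ∨
        inner ℝ (a (b i)) (b j) = -1 := by
  obtain ⟨T, hT, hspan⟩ := hS.exists_isSignedSystem_span_eq_top
  -- A linearly independent spanning subset never contains both a vector and its negative, so its
  -- distinct elements are orthogonal.
  obtain ⟨B, hBT, hB, hli⟩ := exists_linearIndependent ℝ T
  have hon : Orthonormal ℝ ((↑) : B → V) := by
    refine ⟨fun v => hT.norm_eq v (hBT v.2), fun v w hvw => ?_⟩
    rcases hT.pair v (hBT v.2) w (hBT w.2) with h | h | h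
    · exact absurd (Subtype.ext h) hvw
    · refine absurd ?_ (hli.notMem_span_image (s := {w}) (x := v) (by simpa using hvw))
      rw [Set.image_singleton, h]
      exact neg_mem (Submodule.mem_span_singleton_self _)
    · exact h
  have : Fintype B := hli.setFinite.fintype
  let b := OrthonormalBasis.mk hon (by rw [Subtype.range_coe, hB, hspan])
  have hcard : Fintype.card B = Module.finrank ℝ V :=
    (Module.finrank_eq_card_basis b.toBasis).symm
  let b' := b.reindex (Fintype.equivFinOfCardEq hcard)
  have hb' : ∀ i, b' i ∈ T := fun i => by
    simp only [b', b, OrthonormalBasis.reindex_apply, OrthonormalBasis.coe_mk]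
    exact hBT (Subtype.coe_prop _)
  refine ⟨b', fun a ha i j => ?_⟩
  have h1 : inner ℝ (b' j) (b' j) = (1 : ℝ) := by
    rw [real_inner_self_eq_norm_sq, b'.norm_eq_one, one_pow]
  rcases hT.pair _ (hT.map_mem a ha _ (hb' i)) _ (hb' j) with h | h | h
  · right; left; rw [h, h1]
  · right; right; rw [h, inner_neg_left, h1]
  · exact Or.inl h

end SignedSystems

/-! ### Clifford relations and existence of an integral basis -/

section IntegralBasis

variable {U V : Type*}
  [NormedAddCommGroup U] [InnerProductSpace ℝ U] [FiniteDimensional ℝ U]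
  [NormedAddCommGroup V] [InnerProductSpace ℝ V] [FiniteDimensional ℝ V]
  (M : OrthogonalMultiplication U V)

namespace OrthogonalMultiplication

theorem inner_J_J (z : U) (v w : V) : inner ℝ (M.J z v) (M.J z w) = ‖z‖ ^ 2 * inner ℝ v w := by
  have h := M.norm_J z (v + w)
  have h2 := congrArg (· ^ 2) h
  simp only [map_add, mul_pow, norm_add_sq_real, M.norm_J] at h2
  linarith

theorem inner_J_J' (z z' : U) (v : V) :
    inner ℝ (M.J z v) (M.J z' v) = inner ℝ z z' * ‖v‖ ^ 2 := by
  have h := M.norm_J (z + z') v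
  have h2 := congrArg (· ^ 2) h
  simp only [map_add, LinearMap.add_apply, mul_pow, norm_add_sq_real, M.norm_J] at h2
  linarith

theorem J_J_add (z z' : U) (v : V) :
    M.J z (M.J z' v) + M.J z' (M.J z v) = -(2 * inner ℝ z z') • v := by
  have h := M.J_J (z + z') v
  simp only [map_add, LinearMap.add_apply, M.J_J, norm_add_sq_real] at h
  have h2 : M.J z (M.J z' v) + M.J z' (M.J z v) =
    (-(‖z‖ ^ 2) • v + M.J z (M.J z' v) + (M.J z' (M.J z v) + -(‖z'‖ ^ 2) • v)) +
      (‖z‖ ^ 2 + ‖z'‖ ^ 2) • v := by module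
  rw [h2]
  rw [show (-(‖z‖ ^ 2) • v + M.J z (M.J z' v) + (M.J z' (M.J z v) + -(‖z'‖ ^ 2) • v)) =
    -(‖z‖ ^ 2 + 2 * inner ℝ z z' + ‖z'‖ ^ 2) • v by rw [← h]; abel]
  module

theorem isSignMonoid {ι : Type*} [Fintype ι] (z : OrthonormalBasis ι ℝ U) :
    IsSignMonoid (Submonoid.closure (Set.range fun k => (M.J (z k) : Module.End ℝ V))) := by
  refine IsSignMonoid.closure ?_ ?_ ?_
  · rintro _ ⟨k, rfl⟩ v w
    simp [inner_J_J]
  · rintro _ ⟨k, rfl⟩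
    right
    simp [M.J_J]
  · rintro _ ⟨k, rfl⟩ _ ⟨l, rfl⟩
    by_cases hkl : k = l
    · subst hkl
      exact Or.inl fun v => rfl
    · right
      intro v
      have h := M.J_J_add (z k) (z l) v
      rw [z.inner_eq_zero hkl] at h
      simpa [add_eq_zero_iff_eq_neg] using h

/-- This identifies the structure constants with matrix entries of the maps `J (z k)`, so a basis
permuted up to sign is integral. -/
theorem pairing_eq_sum {ι : Type*} [Fintype ι] (z : OrthonormalBasis ι ℝ U) (v w : V) :
    M.pairing v w = ∑ k, inner ℝ (M.J (z k) v) w • z k := by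
  simp only [← M.inner_pairing]
  exact (z.sum_repr' _).symm

theorem _root_.HTypeAlgebra.sum_smul_mk {M : OrthogonalMultiplication U V} {ι : Type*} [Fintype ι]
    (a : ι → ℝ) (u : ι → U) :
    ∑ k, a k • (HTypeAlgebra.mk (u k) 0 : HTypeAlgebra M) =
      HTypeAlgebra.mk (∑ k, a k • u k) 0 := by
  let f : U →ₗ[ℝ] HTypeAlgebra M := LinearMap.inl ℝ U V
  have h : ∀ u, HTypeAlgebra.mk u 0 = f u := fun _ => rfl
  simp only [h, map_sum, map_smul]

theorem exists_integralBasis :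
    ∃ (z : OrthonormalBasis (Fin (Module.finrank ℝ U)) ℝ U)
      (v : OrthonormalBasis (Fin (Module.finrank ℝ V)) ℝ V), IsIntegralBasis M z v := by
  let z := stdOrthonormalBasis ℝ U
  obtain ⟨v, hv⟩ := (M.isSignMonoid z).exists_orthonormalBasis
  refine ⟨z, v, fun k i j => inner ℝ (M.J (z k) (v i)) (v j),
    fun k i j => hv _ (Submonoid.subset_closure ⟨k, rfl⟩) i j, fun i j => ?_⟩
  rw [HTypeAlgebra.sum_smul_mk, ← M.pairing_eq_sum]
  rfl

end OrthogonalMultiplication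

end IntegralBasis

/-! ### Integer combinations of an orthonormal basis -/

section IntegerSpan

variable {ι W : Type*} [Fintype ι] [NormedAddCommGroup W] [InnerProductSpace ℝ W]
  (b : OrthonormalBasis ι ℝ W)

theorem mem_integerSpan_iff {x : W} :
    x ∈ integerSpan b ↔ ∀ i, ∃ n : ℤ, inner ℝ (b i) x = n := by
  classical
  constructor
  · intro hx i
    induction hx using AddSubgroup.closure_induction with
    | mem x hx =>
      obtain ⟨j, rfl⟩ := hx
      by_cases h : i = j
      · exact ⟨1, by rw [b.inner_eq_ite, if_pos h, Int.cast_one]⟩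
      · exact ⟨0, by rw [b.inner_eq_ite, if_neg h, Int.cast_zero]⟩
    | zero => exact ⟨0, by simp⟩
    | add x y _ _ hx hy =>
      obtain ⟨m, hm⟩ := hx
      obtain ⟨n, hn⟩ := hy
      exact ⟨m + n, by rw [inner_add_right, hm, hn, Int.cast_add]⟩
    | neg x _ hx =>
      obtain ⟨m, hm⟩ := hx
      exact ⟨-m, by rw [inner_neg_right, hm, Int.cast_neg]⟩
  · intro h
    choose n hn using h
    rw [← b.sum_repr' x]
    refine AddSubgroup.sum_mem _ fun i _ => ?_
    rw [hn, Int.cast_smul_eq_zsmul]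
    exact AddSubgroup.zsmul_mem _ (AddSubgroup.subset_closure (Set.mem_range_self i)) _

theorem apply_mem_integerSpan (i : ι) : b i ∈ integerSpan b :=
  AddSubgroup.subset_closure (Set.mem_range_self i)

theorem eq_zero_of_mem_integerSpan {x : W} (hx : x ∈ integerSpan b) (h : ‖x‖ < 1) : x = 0 := by
  rw [← b.sum_repr' x]
  refine Finset.sum_eq_zero fun i _ => ?_
  obtain ⟨n, hn⟩ := (mem_integerSpan_iff b).mp hx i
  have h1 : |(n : ℝ)| < 1 := by
    rw [← hn]
    refine (abs_real_inner_le_norm _ _).trans_lt ?_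
    rwa [b.norm_eq_one, one_mul]
  have h2 : n = 0 := Int.abs_lt_one_iff.mp (by exact_mod_cast h1)
  rw [hn, h2, Int.cast_zero, zero_smul]

theorem exists_mem_integerSpan_norm_sub_le (x : W) :
    ∃ w ∈ integerSpan b, ‖x - w‖ ≤ Fintype.card ι := by
  -- Rounding down leaves a combination of unit vectors with coefficients in `[0, 1)`; the triangle
  -- inequality gives the crude bound by the number of vectors.
  refine ⟨∑ i, ⌊(inner ℝ (b i) x : ℝ)⌋ • b i, AddSubgroup.sum_mem _ fun i _ =>
    AddSubgroup.zsmul_mem _ (apply_mem_integerSpan b i) _, ?_⟩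
  have h : x - ∑ i, ⌊(inner ℝ (b i) x : ℝ)⌋ • b i =
      ∑ i, Int.fract (inner ℝ (b i) x : ℝ) • b i := by
    rw [sub_eq_iff_eq_add, ← Finset.sum_add_distrib]
    conv_lhs => rw [← b.sum_repr' x]
    refine Finset.sum_congr rfl fun i _ => ?_
    rw [← Int.cast_smul_eq_zsmul ℝ, ← add_smul, Int.fract_add_floor]
  rw [h]
  refine (norm_sum_le _ _).trans ((Finset.sum_le_card_nsmul _ _ 1 fun i _ => ?_).trans ?_)
  · rw [norm_smul, b.norm_eq_one, mul_one, Real.norm_eq_abs, Int.abs_fract]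
    exact (Int.fract_lt_one _).le
  · simp

end IntegerSpan

/-! ### The lattice and its commutator subgroup -/

section Lattice

open scoped commutatorElement

variable {U V : Type*}
  [NormedAddCommGroup U] [InnerProductSpace ℝ U] [FiniteDimensional ℝ U]
  [NormedAddCommGroup V] [InnerProductSpace ℝ V] [FiniteDimensional ℝ V]
  {M : OrthogonalMultiplication U V} {ι κ : Type*} [Fintype ι] [Fintype κ]
  {z : OrthonormalBasis ι ℝ U} {v : OrthonormalBasis κ ℝ V}

namespace IsIntegralBasis

theorem pairing_apply_mem (h : IsIntegralBasis M z v) (i j : κ) :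
    M.pairing (v i) (v j) ∈ integerSpan z := by
  obtain ⟨A, hA, hz⟩ := h
  have h1 := congrArg Prod.fst (hz i j)
  rw [HTypeAlgebra.sum_smul_mk] at h1
  change M.pairing (v i) (v j) = ∑ k, A k i j • z k at h1
  rw [h1]
  refine AddSubgroup.sum_mem _ fun k _ => ?_
  have hk := apply_mem_integerSpan z k
  rcases hA k i j with h2 | h2 | h2 <;> rw [h2]
  · rw [zero_smul]; exact zero_mem _
  · rwa [one_smul]
  · rw [neg_one_smul]; exact neg_mem hk

theorem pairing_mem (h : IsIntegralBasis M z v) {x y : V} (hx : x ∈ integerSpan v)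
    (hy : y ∈ integerSpan v) : M.pairing x y ∈ integerSpan z := by
  induction hx using AddSubgroup.closure_induction with
  | mem x hx =>
    obtain ⟨i, rfl⟩ := hx
    induction hy using AddSubgroup.closure_induction with
    | mem y hy =>
      obtain ⟨j, rfl⟩ := hy
      exact h.pairing_apply_mem i j
    | zero => rw [M.pairing_zero_right]; exact zero_mem _
    | add x y _ _ hx hy => rw [M.pairing_add_right]; exact add_mem hx hy
    | neg x _ hx => rw [M.pairing_neg_right]; exact neg_mem hx
  | zero => rw [M.pairing_zero_left]; exact zero_mem _
  | add x y _ _ hx hy => rw [M.pairing_add_left]; exact add_mem hx hy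
  | neg x _ hx => rw [M.pairing_neg_left]; exact neg_mem hx

/-- The coordinates of `J (z k) (v i)` are structure constants, hence integers. This places the
second entry of the commutator that produces `z k` in the lattice. -/
theorem J_apply_mem (h : IsIntegralBasis M z v) (k : ι) (i : κ) :
    M.J (z k) (v i) ∈ integerSpan v := by
  rw [mem_integerSpan_iff]
  intro j
  rw [real_inner_comm, ← M.inner_pairing]
  exact (mem_integerSpan_iff z).mp (h.pairing_apply_mem i j) k

end IsIntegralBasis

theorem OrthogonalMultiplication.pairing_J (M : OrthogonalMultiplication U V) (z : U) (v : V) :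
    M.pairing v (M.J z v) = ‖v‖ ^ 2 • z := by
  refine ext_inner_left ℝ fun z' => ?_
  rw [M.inner_pairing, M.inner_J_J', inner_smul_right, mul_comm]

theorem mem_hTypeLattice_iff {x : HTypeGroup M} : x ∈ hTypeLattice M z v ↔
    (2 : ℝ) • (HTypeGroup.toProd x).1 ∈ integerSpan z ∧
      (HTypeGroup.toProd x).2 ∈ integerSpan v := by
  constructor
  · rintro ⟨u, hu, w, hw, rfl⟩
    refine ⟨?_, hw⟩
    change (2 : ℝ) • (1 / 2 : ℝ) • u ∈ _
    rwa [smul_smul, mul_one_div_cancel two_ne_zero, one_smul]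
  · rintro ⟨hu, hw⟩
    refine ⟨_, hu, _, hw, ?_⟩
    rw [smul_smul, one_div_mul_cancel two_ne_zero, one_smul]
    rfl

theorem mem_hTypeCenterLattice_iff {x : HTypeGroup M} : x ∈ hTypeCenterLattice M z ↔
    (HTypeGroup.toProd x).1 ∈ integerSpan z ∧ (HTypeGroup.toProd x).2 = 0 := by
  constructor
  · rintro ⟨u, hu, rfl⟩
    exact ⟨hu, rfl⟩
  · rintro ⟨hu, hw⟩
    exact ⟨_, hu, HTypeGroup.toProd.injective (Prod.ext rfl hw)⟩

/-- The two halves from the products add up to a full bracket; hence the commutators of `L` fall in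
`U_ℤ` rather than only in `½ U_ℤ`. -/
theorem HTypeGroup.toProd_commutator (x y : HTypeGroup M) :
    toProd ⁅x, y⁆ = (M.pairing (toProd x).2 (toProd y).2, 0) := by
  have h : M.pairing (toProd y).2 (toProd x).2 = -M.pairing (toProd x).2 (toProd y).2 := by
    have h1 := M.pairing_self ((toProd x).2 + (toProd y).2)
    rw [M.pairing_add_left, M.pairing_add_right, M.pairing_add_right, M.pairing_self,
      M.pairing_self, zero_add, add_zero] at h1
    exact eq_neg_of_add_eq_zero_right h1
  rw [commutatorElement_def]
  simp only [toProd_mul, toProd_inv, Prod.fst_neg, Prod.snd_neg, M.pairing_add_left,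
    M.pairing_neg_left, M.pairing_neg_right, M.pairing_self, h]
  refine Prod.ext ?_ ?_
  · simp only
    module
  · simp only
    abel

/-- The lattice `½ U_ℤ ⊕ V_ℤ` of an integral basis, as a subgroup. -/
def IsIntegralBasis.lattice (h : IsIntegralBasis M z v) : Subgroup (HTypeGroup M) where
  carrier := hTypeLattice M z v
  one_mem' := by
    rw [mem_hTypeLattice_iff, HTypeGroup.toProd_one]
    simp
  mul_mem' {x y} hx hy := by
    rw [mem_hTypeLattice_iff] at hx hy ⊢
    rw [HTypeGroup.toProd_mul]
    refine ⟨?_, add_mem hx.2 hy.2⟩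
    rw [smul_add, smul_add, smul_smul, mul_one_div_cancel two_ne_zero, one_smul]
    exact add_mem (add_mem hx.1 hy.1) (h.pairing_mem hx.2 hy.2)
  inv_mem' {x} hx := by
    rw [mem_hTypeLattice_iff] at hx ⊢
    rw [HTypeGroup.toProd_inv, Prod.fst_neg, Prod.snd_neg, smul_neg]
    exact ⟨neg_mem hx.1, neg_mem hx.2⟩

/-- The group `U_ℤ` of an integral basis, as a subgroup. -/
def hTypeCenterSubgroup (M : OrthogonalMultiplication U V) (z : OrthonormalBasis ι ℝ U) :
    Subgroup (HTypeGroup M) where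
  carrier := hTypeCenterLattice M z
  one_mem' := by
    rw [mem_hTypeCenterLattice_iff, HTypeGroup.toProd_one]
    simp
  mul_mem' {x y} hx hy := by
    rw [mem_hTypeCenterLattice_iff] at hx hy ⊢
    rw [HTypeGroup.toProd_mul, hx.2, hy.2, M.pairing_zero_left, smul_zero, add_zero, add_zero]
    exact ⟨add_mem hx.1 hy.1, rfl⟩
  inv_mem' {x} hx := by
    rw [mem_hTypeCenterLattice_iff] at hx ⊢
    rw [HTypeGroup.toProd_inv, Prod.fst_neg, Prod.snd_neg, hx.2]
    exact ⟨neg_mem hx.1, neg_zero⟩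

namespace IsIntegralBasis

theorem discreteTopology_lattice (h : IsIntegralBasis M z v) : DiscreteTopology h.lattice := by
  refine discreteTopology_of_isOpen_singleton_one ?_
  have h1 : ({1} : Set h.lattice) = (fun x : h.lattice => HTypeGroup.toProd (x : HTypeGroup M)) ⁻¹'
      {p | ‖(2 : ℝ) • p.1‖ < 1 ∧ ‖p.2‖ < 1} := by
    ext x
    constructor
    · rintro rfl
      simp [HTypeGroup.toProd_one]
    · rintro ⟨hx1, hx2⟩
      obtain ⟨hu, hw⟩ := mem_hTypeLattice_iff.mp x.2
      have hu0 := eq_zero_of_mem_integerSpan z hu hx1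
      have hw0 := eq_zero_of_mem_integerSpan v hw hx2
      refine Subtype.ext (HTypeGroup.toProd.injective (Prod.ext ?_ hw0))
      exact (smul_eq_zero.mp hu0).resolve_left two_ne_zero
  rw [h1]
  refine IsOpen.preimage (HTypeGroup.toProd.continuous.comp continuous_subtype_val) ?_
  exact (isOpen_lt (continuous_fst.const_smul (2 : ℝ)).norm continuous_const).inter
    (isOpen_lt continuous_snd.norm continuous_const)

theorem isCocompactLattice_lattice (h : IsIntegralBasis M z v) :
    IsCocompactLattice h.lattice := by
  refine ⟨h.discreteTopology_lattice, ?_⟩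
  refine compactSpace_quotient_of_isCompact (K := HTypeGroup.toProd ⁻¹'
    (Metric.closedBall 0 (Fintype.card ι) ×ˢ Metric.closedBall 0 (Fintype.card κ))) ?_ fun x => ?_
  · rw [Homeomorph.isCompact_preimage]
    exact (isCompact_closedBall _ _).prod (isCompact_closedBall _ _)
  -- First `w` rounds the `V` part; then `u` rounds twice the `U` part after the correction by `[x,
  -- w]` that multiplication by `-w` causes. Thus `x * g` is bounded in both components.
  obtain ⟨w, hw, hxw⟩ := exists_mem_integerSpan_norm_sub_le v (HTypeGroup.toProd x).2
  obtain ⟨u, hu, hxu⟩ := exists_mem_integerSpan_norm_sub_le z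
    ((2 : ℝ) • (HTypeGroup.toProd x).1 - M.pairing (HTypeGroup.toProd x).2 w)
  let g : HTypeGroup M := HTypeGroup.toProd.symm (-((1 / 2 : ℝ) • u), -w)
  have hg : g ∈ h.lattice := by
    refine mem_hTypeLattice_iff.mpr ⟨?_, neg_mem hw⟩
    change (2 : ℝ) • (-((1 / 2 : ℝ) • u)) ∈ _
    rw [smul_neg, smul_smul, mul_one_div_cancel two_ne_zero, one_smul]
    exact neg_mem hu
  refine ⟨x * g, ?_, by simpa using inv_mem hg⟩
  rw [Set.mem_preimage, HTypeGroup.toProd_mul, HTypeGroup.toProd.apply_symm_apply]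
  refine ⟨?_, ?_⟩
  · rw [mem_closedBall_zero_iff]
    simp only [M.pairing_neg_right]
    rw [show (HTypeGroup.toProd x).1 + -((1 / 2 : ℝ) • u) +
      (1 / 2 : ℝ) • -M.pairing (HTypeGroup.toProd x).2 w = (1 / 2 : ℝ) •
        ((2 : ℝ) • (HTypeGroup.toProd x).1 - M.pairing (HTypeGroup.toProd x).2 w - u) by module,
      norm_smul, Real.norm_of_nonneg (by norm_num)]
    linarith [norm_nonneg
      ((2 : ℝ) • (HTypeGroup.toProd x).1 - M.pairing (HTypeGroup.toProd x).2 w - u)]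
  · rw [mem_closedBall_zero_iff]
    simpa only [← sub_eq_add_neg] using hxw

theorem commutator_lattice (h : IsIntegralBasis M z v) (hUV : Nontrivial V ∨ Subsingleton U) :
    ⁅h.lattice, h.lattice⁆ = hTypeCenterSubgroup M z := by
  refine le_antisymm (Subgroup.commutator_le.mpr fun x hx y hy => ?_) ?_
  · refine mem_hTypeCenterLattice_iff.mpr ?_
    rw [HTypeGroup.toProd_commutator]
    exact ⟨h.pairing_mem (mem_hTypeLattice_iff.mp hx).2 (mem_hTypeLattice_iff.mp hy).2, rfl⟩
  · rintro _ ⟨u, hu, rfl⟩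
    have hadd : ∀ a b : U, HTypeGroup.exp (HTypeAlgebra.mk (a + b) 0 : HTypeAlgebra M) =
        HTypeGroup.exp (HTypeAlgebra.mk a 0) * HTypeGroup.exp (HTypeAlgebra.mk b 0) := by
      intro a b
      rw [HTypeGroup.exp_mul_exp]
      congr 1
      ext
      · change a + b = a + b + (1 / 2 : ℝ) • M.pairing 0 0
        rw [M.pairing_zero_left, smul_zero, add_zero]
      · change (0 : V) = 0 + 0 + (1 / 2 : ℝ) • (0 : V)
        rw [smul_zero, add_zero, add_zero]
    have hzero : HTypeGroup.exp (HTypeAlgebra.mk 0 0 : HTypeAlgebra M) = 1 := rfl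
    induction hu using AddSubgroup.closure_induction with
    | mem u hu =>
      obtain ⟨k, rfl⟩ := hu
      rcases hUV with hV | hU
      -- For any unit basis vector `v i`, `[v i, J (z k) (v i)] = z k`; this is where `V ≠ 0`
      -- enters.
      · obtain ⟨i⟩ := v.toBasis.index_nonempty
        let x : HTypeGroup M := HTypeGroup.exp (HTypeAlgebra.mk 0 (v i))
        let y : HTypeGroup M := HTypeGroup.exp (HTypeAlgebra.mk 0 (M.J (z k) (v i)))
        have hmem : ∀ w ∈ integerSpan v,
            HTypeGroup.exp (HTypeAlgebra.mk 0 w : HTypeAlgebra M) ∈ h.lattice := fun w hw =>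
          ⟨0, zero_mem _, w, hw, by rw [smul_zero]⟩
        have hxy : HTypeGroup.exp (HTypeAlgebra.mk (z k) 0 : HTypeAlgebra M) = ⁅x, y⁆ := by
          refine HTypeGroup.toProd.injective ?_
          rw [HTypeGroup.toProd_commutator]
          refine Prod.ext ?_ rfl
          change z k = M.pairing (v i) (M.J (z k) (v i))
          rw [M.pairing_J, v.norm_eq_one, one_pow, one_smul]
        rw [hxy]
        exact Subgroup.commutator_mem_commutator (hmem _ (apply_mem_integerSpan v i))
          (hmem _ (h.J_apply_mem k i))
      · rw [Subsingleton.elim (z k) 0, hzero]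
        exact one_mem _
    | zero => rw [hzero]; exact one_mem _
    | add a b _ _ ha hb => rw [hadd]; exact mul_mem ha hb
    | neg a _ ha =>
      rw [eq_inv_of_mul_eq_one_left (a := HTypeGroup.exp (HTypeAlgebra.mk (-a) 0 : HTypeAlgebra M))
        (by rw [← hadd, neg_add_cancel, hzero])]
      exact inv_mem ha

end IsIntegralBasis

end Lattice

theorem mainTheorem3 {U V : Type*}
    [NormedAddCommGroup U] [InnerProductSpace ℝ U] [FiniteDimensional ℝ U]
    [NormedAddCommGroup V] [InnerProductSpace ℝ V] [FiniteDimensional ℝ V]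
    (M : OrthogonalMultiplication U V) :
    -- an integral basis exists
    (∃ (z : OrthonormalBasis (Fin (Module.finrank ℝ U)) ℝ U)
       (v : OrthonormalBasis (Fin (Module.finrank ℝ V)) ℝ V), IsIntegralBasis M z v) ∧
    -- each integral basis yields a cocompact lattice in `N = U ⊕ V`
    (∀ (z : OrthonormalBasis (Fin (Module.finrank ℝ U)) ℝ U)
       (v : OrthonormalBasis (Fin (Module.finrank ℝ V)) ℝ V), IsIntegralBasis M z v →
      ∃ L : Subgroup (HTypeGroup M), (L : Set (HTypeGroup M)) = hTypeLattice M z v ∧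
        IsCocompactLattice L ∧
        ((Nontrivial V ∨ Subsingleton U) →
          ((⁅L, L⁆ : Subgroup (HTypeGroup M)) : Set (HTypeGroup M)) = hTypeCenterLattice M z)) ∧
    -- each simply connected Lie group with Lie algebra `U ⊕ V` is identified with `N` by its
    -- exponential map, and contains the corresponding cocompact lattices
    (∀ (d : ℕ) (G : Type*) [TopologicalSpace G] [T2Space G]
       [ChartedSpace (EuclideanSpace ℝ (Fin d)) G] [Group G] [LieGroup (𝓡 d) ∞ G]
       [SimplyConnectedSpace G] (φ : HTypeAlgebra M ≃ₗ⁅ℝ⁆ GroupLieAlgebra (𝓡 d) G),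
      ∃ e : GroupLieAlgebra (𝓡 d) G → G, IsLieExp e ∧
        ∃ F : HTypeGroup M ≃ₜ* G, (∀ X : HTypeAlgebra M, F (HTypeGroup.exp X) = e (φ X)) ∧
          ∀ (z : OrthonormalBasis (Fin (Module.finrank ℝ U)) ℝ U)
            (v : OrthonormalBasis (Fin (Module.finrank ℝ V)) ℝ V), IsIntegralBasis M z v →
            ∃ Γ : Subgroup G, (Γ : Set G) = F '' hTypeLattice M z v ∧ IsCocompactLattice Γ) := by
  refine ⟨M.exists_integralBasis, fun z v h => ⟨h.lattice, rfl, h.isCocompactLattice_lattice,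
    fun hUV => by rw [h.commutator_lattice hUV]; rfl⟩, ?_⟩
  intro d G _ _ _ _ _ _ φ
  obtain ⟨e, he0, he⟩ := exists_lieExp (EuclideanSpace ℝ (Fin d)) G
  obtain ⟨F, hF⟩ := exists_continuousMulEquiv_lieExp he0 he φ
  exact ⟨e, ⟨he0, fun X t => he X t⟩, F, hF, fun z v h =>
    ⟨h.lattice.map (F : HTypeGroup M →* G), rfl, h.isCocompactLattice_lattice.map_equiv F⟩⟩
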